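/- **Theorem (Henkin completeness of $\mathrm{SC}_{\mathrm{FO(ID)}}$).** Let $\Gamma$ and $\Delta$ be finite sets of first-order formulas and $\Phi_1,\dots,\Phi_n$ ($n\ge 0$) definitions. If the (regular) sequent $\Gamma,\Phi_1,\dots,\Phi_n\vdash\Delta$ is valid under the Henkin semantics, then it is provable in the sequent calculus $\mathrm{SC}_{\mathrm{FO(ID)}}$. **Syntax.** A vocabulary consists of predicate symbols and function symbols with arities, with an infinite supply of object symbols ($0$-ary function symbols that quantifiers may bind; free occurrences act as constants). FO-formulas are built from atoms $P(\bar t)$, $t=s$, $\top$, $\bot$ with $\lnot,\land,\lor,\Rightarrow,\Leftrightarrow,\forall,\exists$; formulas are identified up to renaming of bound object symbols, and substitution is capture-avoiding. A definition $\Phi$ is a finite set of rules $\forall\bar x: P(\bar t)\leftarrow\varphi$ with $\varphi$ an FO-formula, where the object symbols $\bar x$ are bound; $\mathrm{def}(\Phi)$ is the set of predicates in heads of rules of $\Phi$. FO(ID)-formulas are built like FO-formulas, with definitions allowed as additional atoms. An occurrence is positive (negative) if it lies under an even (odd) number of negations, after unwinding $\varphi\Rightarrow\psi$ as $\lnot\varphi\lor\psi$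 and $\varphi\Leftrightarrow\psi$ as $(\varphi\Rightarrow\psi)\land(\psi\Rightarrow\varphi)$. **Henkin semantics.** A Henkin class for a structure $\mathcal I$ with domain $D$ is a family $\mathcal H=(H_k)_{k\in\mathbb N}$, $H_k\subseteq\mathcal P(D^k)$, such that: $\{(a,a)\mid a\in D\}\in H_2$; $Q^{\mathcal I}\in H_k$ for every $k$-ary predicate $Q$; if $R\in H_{k+1}$ and $a\in D$, then $\{\bar a\in D^k\mid(\bar a,a)\in R\}\in H_k$ and $\{\bar a\in D^k\mid(\bar a,b)\in R\text{ for all }b\in D\}\in H_k$; each $H_k$ is closed under complement and binary intersection; and if $R\in H_k$, $\bar t$ is a $k$-tuple of terms, $x_1,\dots,x_p,y_1,\dots,y_q$ are distinct object symbols and $\bar b\in D^q$, then $\{\bar a\in D^p\mid \bar t^{\,\mathcal I[\bar x:\bar a,\bar y:\bar b]}\in R\}\in H_p$. For structures $\mathcal J,\mathcal K$ that agree with $\mathcal I$ except possibly on $\mathrm{def}(\Phi)$ and for $P\in\mathrm{def}(\Phi)$, let $P^{\mathcal C(\mathcal J,\mathcal K)}$ be the set of tuples $\bar a$ satisfying the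 merged body of $P$, i.e. the disjunction of the formulas $\exists\bar x:\bar a=\bar t\land\varphi$ over all rules $\forall\bar x:P(\bar t)\leftarrow\varphi$ of $\Phi$, where positive occurrences of defined predicates in $\varphi$ are interpreted in $\mathcal J$ and negative ones in $\mathcal K$. $\mathcal J$ is an $\mathcal H$-point if $P^{\mathcal J}\in H_k$ for every $k$-ary $P\in\mathrm{def}(\Phi)$, and a pre-fixpoint of $\mathcal C(\cdot,\mathcal I)$ if $P^{\mathcal C(\mathcal J,\mathcal I)}\subseteq P^{\mathcal J}$ for all $P\in\mathrm{def}(\Phi)$. $(\mathcal I,\mathcal H)\models_{\mathrm H}\Phi$ iff $\mathcal I$ is the least pre-fixed $\mathcal H$-point of $\mathcal C(\cdot,\mathcal I)$, with respect to inclusion of the defined predicates. The other clauses of $\models_{\mathrm H}$ are Tarski's. A sequent is valid under the Henkin semantics if, for every structure $\mathcal I$ and every Henkin class $\mathcal H$ for $\mathcal I$, whenever $(\mathcal I,\mathcal H)$ satisfies all formulas on the left it satisfies some formula on the right. **Calculus.** Sequents $\Gamma\vdash\Delta$ consist of sets of FO(ID)-formulas; a proof is a finite tree. $\mathrm{SC}_{\mathrm{FO(ID)}}$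 has the axioms $\Gamma\vdash\Delta$ with $\Gamma\cap\Delta\ne\emptyset$ or $\bot\in\Gamma$ or $\top\in\Delta$; weakening; substitution (from $\Gamma\vdash\Delta$ infer $\Gamma[t/x]\vdash\Delta[t/x]$); cut on any FO(ID)-formula; the usual left and right rules of Gentzen's classical calculus for $\lnot,\lor,\land,\Rightarrow,\Leftrightarrow,\forall,\exists$ (with arbitrary terms in $\forall$L, $\exists$R and fresh object symbols in $\forall$R, $\exists$L); the equality rules ($=$R) $\Gamma\vdash t=t,\Delta$ and ($=$L): from $\Gamma[s/x,t/y]\vdash\Delta[s/x,t/y]$ infer $\Gamma[t/x,s/y],\,t=s\vdash\Delta[t/x,s/y]$; and two rules for defined atoms: * (def R) If $\forall\bar x:P(\bar t)\leftarrow\varphi$ is a rule of $\Phi$ and $\bar s$ is a tuple of object symbols, then from $\Gamma,\Phi\vdash\varphi[\bar s/\bar x],\Delta$ infer $\Gamma,\Phi\vdash P(\bar t[\bar s/\bar x]),\Delta$. * (def L) Let $P\in\Pi\subseteq\mathrm{def}(\Phi)$, and for each $Q\in\Pi$ let $F_Q[\bar z]$ be an FO-formula with distinguished distinct object symbols $\bar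 z$, as many as the arity of $Q$. From the major premise $\Gamma,\Phi,F_P[\bar v]\vdash\Delta$ and the minor premises $\Gamma,\Phi,\psi[F_\Pi/\Pi^+]\vdash F_Q[\bar s],\Delta$, one for each rule $\forall\bar y:Q(\bar s)\leftarrow\psi$ of $\Phi$ with $Q\in\Pi$, infer $\Gamma,\Phi,P(\bar v)\vdash\Delta$. Here $\psi[F_\Pi/\Pi^+]$ replaces each positive occurrence of an atom $R(\bar u)$ with $R\in\Pi$ in $\psi$ by $F_R[\bar u]$, and the quantified object symbols $\bar y$ of the rules of $\Phi$ are named by distinct object symbols that are not free in $\Gamma$, $\Delta$, $\Phi$ and, apart from the distinguished $\bar z$, not free in any $F_Q$, $Q\in\Pi$. -/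

import Mathlib

/-!
Syntax, Henkin semantics and sequent calculus of the logic FO(ID).

A vocabulary consists of the predicate and function symbols of a first-order language `L`,
together with a type `Obj` of object symbols, i.e. the 0-ary function symbols that quantifiers
may bind. A free occurrence of an object symbol plays the role of a constant, a bound one that of
a variable. Bound occurrences are written nameless, which identifies formulas up to renaming of
bound object symbols: an expression at depth `n` may refer to `n` enclosing binders through
`Fin n`, the innermost binder being the last element. Expressions of the logic proper have depth
`0`.
-/

universe u

namespace FOIDLogic



/-- Terms at depth `n`. -/
abbrev Tm (L : FirstOrder.Language.{u, u}) (Obj : Type u) (n : ℕ) : Type u := L.Term (Obj ⊕ Fin n)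

/-- First-order formulas at depth `n`, with a further kind `A` of atomic formulas. -/
inductive Fml (L : FirstOrder.Language.{u, u}) (Obj : Type u) (A : ℕ → Type u) : ℕ → Type u
  | ext {n : ℕ} (a : A n) : Fml L Obj A n
  | verum {n : ℕ} : Fml L Obj A n
  | falsum {n : ℕ} : Fml L Obj A n
  | eq {n : ℕ} (t s : Tm L Obj n) : Fml L Obj A n
  | rel {n k : ℕ} (P : L.Relations k) (ts : Fin k → Tm L Obj n) : Fml L Obj A n
  | neg {n : ℕ} (φ : Fml L Obj A n) : Fml L Obj A n
  | and {n : ℕ} (φ ψ : Fml L Obj A n) : Fml L Obj A n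
  | or {n : ℕ} (φ ψ : Fml L Obj A n) : Fml L Obj A n
  | imp {n : ℕ} (φ ψ : Fml L Obj A n) : Fml L Obj A n
  | iff {n : ℕ} (φ ψ : Fml L Obj A n) : Fml L Obj A n
  | all {n : ℕ} (φ : Fml L Obj A (n + 1)) : Fml L Obj A n
  | ex {n : ℕ} (φ : Fml L Obj A (n + 1)) : Fml L Obj A n

/-- FO-formulas: no further atomic formulas. -/
abbrev FO (L : FirstOrder.Language.{u, u}) (Obj : Type u) (n : ℕ) : Type u :=
  Fml L Obj (fun _ => PEmpty.{u + 1}) n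

/-- A definitional rule `∀ x₁ … x_m : P(t₁, …, t_k) ← φ`. The `m` quantified object symbols are
the last `m` of the `n + m` binders visible in the head and the body. -/
structure DefRule (L : FirstOrder.Language.{u, u}) (Obj : Type u) (n : ℕ) : Type u where
  {arity : ℕ}
  pred : L.Relations arity
  numVars : ℕ
  args : Fin arity → Tm L Obj (n + numVars)
  body : FO L Obj (n + numVars)

/-- A definition is a finite set of definitional rules. -/
abbrev Definition (L : FirstOrder.Language.{u, u}) (Obj : Type u) (n : ℕ) : Type u :=
  Finset (DefRule L Obj n)

/-- FO(ID)-formulas: definitions are admitted as atomic formulas. -/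
abbrev FOID (L : FirstOrder.Language.{u, u}) (Obj : Type u) (n : ℕ) : Type u :=
  Fml L Obj (Definition L Obj) n

/-- The predicate symbols of `L`, of all arities. -/
abbrev PredSym (L : FirstOrder.Language.{u, u}) : Type u := Σ k : ℕ, L.Relations k

/-- The set of defined predicates of a definition. -/
def Definition.defined {L : FirstOrder.Language.{u, u}} {Obj : Type u} {n : ℕ}
    (Φ : Definition L Obj n) : Set (PredSym L) :=
  {P | ∃ r ∈ Φ, P = ⟨r.arity, r.pred⟩}

section SyntaxOps

variable {L : FirstOrder.Language.{u, u}} {Obj : Type u} {A : ℕ → Type u}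

/-- The FO-formulas among the FO(ID)-formulas. -/
def FO.toFml {n : ℕ} : FO L Obj n → Fml L Obj A n
  | .ext a => a.elim
  | .verum => .verum
  | .falsum => .falsum
  | .eq t s => .eq t s
  | .rel P ts => .rel P ts
  | .neg φ => .neg (toFml φ)
  | .and φ ψ => .and (toFml φ) (toFml ψ)
  | .or φ ψ => .or (toFml φ) (toFml ψ)
  | .imp φ ψ => .imp (toFml φ) (toFml ψ)
  | .iff φ ψ => .iff (toFml φ) (toFml ψ)
  | .all φ => .all (toFml φ)
  | .ex φ => .ex (toFml φ)

/-! ### Free object symbols -/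

/-- The object symbols that occur (freely) in a term. -/
def Tm.free {n : ℕ} : Tm L Obj n → Set Obj
  | .var (.inl x) => {x}
  | .var (.inr _) => ∅
  | .func _ ts => ⋃ i, Tm.free (ts i)

/-- The object symbols that occur freely in a formula. -/
def Fml.free (freeA : ∀ n, A n → Set Obj) {n : ℕ} : Fml L Obj A n → Set Obj
  | .ext a => freeA _ a
  | .verum => ∅
  | .falsum => ∅
  | .eq t s => Tm.free t ∪ Tm.free s
  | .rel _ ts => ⋃ i, Tm.free (ts i)
  | .neg φ => φ.free freeA
  | .and φ ψ => φ.free freeA ∪ ψ.free freeA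
  | .or φ ψ => φ.free freeA ∪ ψ.free freeA
  | .imp φ ψ => φ.free freeA ∪ ψ.free freeA
  | .iff φ ψ => φ.free freeA ∪ ψ.free freeA
  | .all φ => φ.free freeA
  | .ex φ => φ.free freeA

/-- The object symbols that occur freely in an FO-formula. -/
def FO.free {n : ℕ} (φ : FO L Obj n) : Set Obj := Fml.free (fun _ a => a.elim) φ

/-- The object symbols that occur freely in a definitional rule. -/
def DefRule.free {n : ℕ} (r : DefRule L Obj n) : Set Obj :=
  (⋃ i, Tm.free (r.args i)) ∪ r.body.free

/-- The object symbols that occur freely in a definition. -/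
def Definition.free {n : ℕ} (Φ : Definition L Obj n) : Set Obj := ⋃ r ∈ Φ, DefRule.free r

/-- The object symbols that occur freely in an FO(ID)-formula. -/
def FOID.free {n : ℕ} (φ : FOID L Obj n) : Set Obj := Fml.free (fun _ Φ => Definition.free Φ) φ

/-- The object symbols that occur freely in a set of FO(ID)-formulas. -/
def freeSet (Γ : Set (FOID L Obj 0)) : Set Obj := ⋃ φ ∈ Γ, FOID.free φ

/-! ### Substitution -/

/-- A simultaneous substitution of terms at depth `m` for the object symbols and the indices of an
expression at depth `n`. -/
abbrev Subst (L : FirstOrder.Language.{u, u}) (Obj : Type u) (n m : ℕ) : Type u :=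
  Obj ⊕ Fin n → Tm L Obj m

/-- A term, seen below `k` further binders. -/
def Tm.weaken {n : ℕ} (k : ℕ) (t : Tm L Obj n) : Tm L Obj (n + k) :=
  t.relabel (Sum.map id (Fin.castAdd k))

/-- The substitution below `k` further binders, which it leaves alone. -/
def Subst.lift {n m : ℕ} (k : ℕ) (σ : Subst L Obj n m) : Subst L Obj (n + k) (m + k) :=
  Sum.elim (fun x => Tm.weaken k (σ (.inl x)))
    (Fin.addCases (fun i => Tm.weaken k (σ (.inr i))) (fun j => .var (.inr (Fin.natAdd m j))))

/-- Capture-avoiding simultaneous substitution in a formula. -/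
def Fml.subst (substA : ∀ n m, Subst L Obj n m → A n → A m) {n : ℕ} (φ : Fml L Obj A n) :
    ∀ {m : ℕ}, Subst L Obj n m → Fml L Obj A m :=
  match φ with
  | .ext a => fun σ => .ext (substA _ _ σ a)
  | .verum => fun _ => .verum
  | .falsum => fun _ => .falsum
  | .eq t s => fun σ => .eq (t.subst σ) (s.subst σ)
  | .rel P ts => fun σ => .rel P (fun i => (ts i).subst σ)
  | .neg φ => fun σ => .neg (φ.subst substA σ)
  | .and φ ψ => fun σ => .and (φ.subst substA σ) (ψ.subst substA σ)
  | .or φ ψ => fun σ => .or (φ.subst substA σ) (ψ.subst substA σ)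
  | .imp φ ψ => fun σ => .imp (φ.subst substA σ) (ψ.subst substA σ)
  | .iff φ ψ => fun σ => .iff (φ.subst substA σ) (ψ.subst substA σ)
  | .all φ => fun σ => .all (φ.subst substA (Subst.lift 1 σ))
  | .ex φ => fun σ => .ex (φ.subst substA (Subst.lift 1 σ))

/-- Substitution in an FO-formula. -/
def FO.subst {n m : ℕ} (σ : Subst L Obj n m) (φ : FO L Obj n) : FO L Obj m :=
  Fml.subst (fun _ _ _ a => a.elim) φ σ

/-- Substitution in a definitional rule. -/
def DefRule.subst {n m : ℕ} (σ : Subst L Obj n m) (r : DefRule L Obj n) : DefRule L Obj m where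
  pred := r.pred
  numVars := r.numVars
  args := fun i => (r.args i).subst (Subst.lift r.numVars σ)
  body := r.body.subst (Subst.lift r.numVars σ)

open Classical in
/-- Substitution in a definition. -/
noncomputable def Definition.subst {n m : ℕ} (σ : Subst L Obj n m) (Φ : Definition L Obj n) :
    Definition L Obj m :=
  Finset.image (DefRule.subst σ) Φ

/-- Substitution in an FO(ID)-formula. -/
noncomputable def FOID.subst {n m : ℕ} (σ : Subst L Obj n m) (φ : FOID L Obj n) : FOID L Obj m :=
  Fml.subst (fun _ _ σ Φ => Definition.subst σ Φ) φ σ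

/-- The substitution that replaces the `k` innermost binders by the terms `s₁, …, s_k`. -/
def instWith {n k : ℕ} (s : Fin k → Tm L Obj n) : Subst L Obj (n + k) n :=
  Sum.elim (fun x => .var (.inl x)) (Fin.addCases (fun i => .var (.inr i)) s)

/-- The substitution that replaces the indices of an expression at depth `k` by the terms
`s₁, …, s_k`, and leaves its object symbols alone. -/
def plugIn {n k : ℕ} (s : Fin k → Tm L Obj n) : Subst L Obj k n :=
  Sum.elim (fun x => .var (.inl x)) s

/-- An object symbol as a term. -/
def objTm {n : ℕ} (x : Obj) : Tm L Obj n := .var (.inl x)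

open Classical in
/-- The substitution `[t / x]`. -/
noncomputable def single (x : Obj) (t : Tm L Obj 0) : Subst L Obj 0 0 :=
  Sum.elim (fun z => if z = x then t else .var (.inl z)) (fun i => .var (.inr i))

open Classical in
/-- The simultaneous substitution `[t / x, s / y]`. -/
noncomputable def double (x : Obj) (t : Tm L Obj 0) (y : Obj) (s : Tm L Obj 0) :
    Subst L Obj 0 0 :=
  Sum.elim (fun z => if z = x then t else if z = y then s else .var (.inl z))
    (fun i => .var (.inr i))

open Classical in
/-- `φ.replace S F true` is `φ[F_S / S⁺]`: every positive occurrence in `φ` of an atom `R(ū)` with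
`R ∈ S` is replaced by `F_R[ū]`; `φ.replace S F false` replaces the negative occurrences instead.
Here `F_R` has its places for the arguments of `R` as indices. The sign of an occurrence refers to
the unwinding of `φ ⇒ ψ` as `¬φ ∨ ψ` and of `φ ⇔ ψ` as `(φ ⇒ ψ) ∧ (ψ ⇒ φ)`. -/
noncomputable def FO.replace (S : Set (PredSym L)) (F : ∀ k, L.Relations k → FO L Obj k) {n : ℕ} :
    Bool → FO L Obj n → FO L Obj n
  | _, .ext a => .ext a
  | _, .verum => .verum
  | _, .falsum => .falsum
  | _, .eq t s => .eq t s
  | b, .rel (k := k) P ts =>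
      if b = true ∧ (⟨k, P⟩ : PredSym L) ∈ S then FO.subst (plugIn ts) (F k P) else .rel P ts
  | b, .neg φ => .neg (replace S F (!b) φ)
  | b, .and φ ψ => .and (replace S F b φ) (replace S F b ψ)
  | b, .or φ ψ => .or (replace S F b φ) (replace S F b ψ)
  | b, .imp φ ψ => .imp (replace S F (!b) φ) (replace S F b ψ)
  | b, .iff φ ψ => .and (.imp (replace S F (!b) φ) (replace S F b ψ))
      (.imp (replace S F (!b) ψ) (replace S F b φ))
  | b, .all φ => .all (replace S F b φ)
  | b, .ex φ => .ex (replace S F b φ)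

end SyntaxOps

/-! ### Semantics

A structure consists of a domain `D`, an `L.Structure` on it, and an interpretation
`v : Obj → D` of the object symbols. -/

section Semantics

variable {L : FirstOrder.Language.{u, u}} {Obj : Type u} {A : ℕ → Type u} {D : Type u}

/-- An interpretation of the predicate symbols on the domain `D`. -/
abbrev RelInterp (L : FirstOrder.Language.{u, u}) (D : Type u) : Type u :=
  ∀ k : ℕ, L.Relations k → Set (Fin k → D)

variable [L.Structure D]

/-- The interpretation of the predicate symbols given by the structure. -/
def stdRel (L : FirstOrder.Language.{u, u}) (D : Type u) [L.Structure D] : RelInterp L D :=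
  fun _ P => {a | FirstOrder.Language.Structure.RelMap P a}

/-- The value of a term; `e` interprets the indices. -/
def Tm.val {n : ℕ} (v : Obj → D) (e : Fin n → D) (t : Tm L Obj n) : D :=
  t.realize (Sum.elim v e)

/-- Satisfaction of a formula, given the satisfaction `satA` of the further atomic formulas. -/
def Fml.Sat (v : Obj → D) (satA : ∀ n, (Fin n → D) → A n → Prop) {n : ℕ} :
    Fml L Obj A n → (Fin n → D) → Prop
  | .ext a, e => satA _ e a
  | .verum, _ => True
  | .falsum, _ => False
  | .eq t s, e => Tm.val v e t = Tm.val v e s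
  | .rel P ts, e => (fun i => Tm.val v e (ts i)) ∈ stdRel L D _ P
  | .neg φ, e => ¬ φ.Sat v satA e
  | .and φ ψ, e => φ.Sat v satA e ∧ ψ.Sat v satA e
  | .or φ ψ, e => φ.Sat v satA e ∨ ψ.Sat v satA e
  | .imp φ ψ, e => φ.Sat v satA e → ψ.Sat v satA e
  | .iff φ ψ, e => (φ.Sat v satA e ↔ ψ.Sat v satA e)
  | .all φ, e => ∀ d : D, φ.Sat v satA (Fin.snoc e d)
  | .ex φ, e => ∃ d : D, φ.Sat v satA (Fin.snoc e d)

/-- Satisfaction of an FO-formula whose positive occurrences of predicate symbols are interpreted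
by `pos` and whose negative ones by `neg`. -/
def FO.PolSat (v : Obj → D) {n : ℕ} :
    FO L Obj n → RelInterp L D → RelInterp L D → (Fin n → D) → Prop
  | .ext a, _, _, _ => a.elim
  | .verum, _, _, _ => True
  | .falsum, _, _, _ => False
  | .eq t s, _, _, e => Tm.val v e t = Tm.val v e s
  | .rel P ts, pos, _, e => (fun i => Tm.val v e (ts i)) ∈ pos _ P
  | .neg φ, pos, neg, e => ¬ PolSat v φ neg pos e
  | .and φ ψ, pos, neg, e => PolSat v φ pos neg e ∧ PolSat v ψ pos neg e
  | .or φ ψ, pos, neg, e => PolSat v φ pos neg e ∨ PolSat v ψ pos neg e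
  | .imp φ ψ, pos, neg, e => PolSat v φ neg pos e → PolSat v ψ pos neg e
  | .iff φ ψ, pos, neg, e => (PolSat v φ neg pos e → PolSat v ψ pos neg e) ∧
      (PolSat v ψ neg pos e → PolSat v φ pos neg e)
  | .all φ, pos, neg, e => ∀ d : D, PolSat v φ pos neg (Fin.snoc e d)
  | .ex φ, pos, neg, e => ∃ d : D, PolSat v φ pos neg (Fin.snoc e d)

/-- If both signs are interpreted by the structure, this is ordinary satisfaction. -/
theorem FO.polSat_std (v : Obj → D) (satA : ∀ n, (Fin n → D) → PEmpty.{u + 1} → Prop) {n : ℕ}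
    (φ : FO L Obj n) (e : Fin n → D) :
    FO.PolSat v φ (stdRel L D) (stdRel L D) e ↔ Fml.Sat v satA φ e := by
  induction φ with
  | ext a => exact a.elim
  | verum => exact Iff.rfl
  | falsum => exact Iff.rfl
  | eq t s => exact Iff.rfl
  | rel P ts => exact Iff.rfl
  | neg φ ih => exact not_congr (ih e)
  | and φ ψ ih₁ ih₂ => exact and_congr (ih₁ e) (ih₂ e)
  | or φ ψ ih₁ ih₂ => exact or_congr (ih₁ e) (ih₂ e)
  | imp φ ψ ih₁ ih₂ => exact imp_congr (ih₁ e) (ih₂ e)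
  | iff φ ψ ih₁ ih₂ =>
    simp only [FO.PolSat, Fml.Sat, ih₁ e, ih₂ e]
    exact iff_iff_implies_and_implies.symm
  | all φ ih => exact forall_congr' fun d => ih _
  | ex φ ih => exact exists_congr fun d => ih _

/-- `H` is a Henkin class for the structure `(D, v)`. For distinct object symbols `x`, the
interpretation `v[x : a]` is `Function.extend x a v`. -/
structure IsHenkinClass (L : FirstOrder.Language.{u, u}) {Obj : Type u} {D : Type u} [L.Structure D]
    (v : Obj → D) (H : ∀ k : ℕ, Set (Set (Fin k → D))) : Prop where
  equality : {a : Fin 2 → D | a 0 = a 1} ∈ H 2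
  predicate : ∀ {k : ℕ} (Q : L.Relations k), stdRel L D k Q ∈ H k
  projection : ∀ {k : ℕ} (R : Set (Fin (k + 1) → D)) (d : D), R ∈ H (k + 1) →
    {a : Fin k → D | (Fin.snoc a d : Fin (k + 1) → D) ∈ R} ∈ H k
  terms : ∀ {k n m : ℕ} (R : Set (Fin k → D)) (t : Fin k → Tm L Obj 0)
    (x : Fin n → Obj) (y : Fin m → Obj) (b : Fin m → D), R ∈ H k →
    Function.Injective x → Function.Injective y → (∀ i j, x i ≠ y j) →
    {a : Fin n → D | (fun i =>
      Tm.val (Function.extend x a (Function.extend y b v)) Fin.elim0 (t i)) ∈ R} ∈ H n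
  complement : ∀ {k : ℕ} (R : Set (Fin k → D)), R ∈ H k → Rᶜ ∈ H k
  intersection : ∀ {k : ℕ} (R S : Set (Fin k → D)), R ∈ H k → S ∈ H k → R ∩ S ∈ H k
  universal : ∀ {k : ℕ} (R : Set (Fin (k + 1) → D)), R ∈ H (k + 1) →
    {a : Fin k → D | ∀ d : D, (Fin.snoc a d : Fin (k + 1) → D) ∈ R} ∈ H k

/-- Membership in the relations `P^C(J, I)`, for `P` a defined predicate of `Φ`: the tuple `a`
satisfies the merged body of `P`, that is, the disjunction of the formulas `∃ x̄ : a = t̄ ∧ φ` over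
the rules `∀ x̄ : P(t̄) ← φ` of `Φ`, if its positive occurrences of defined predicates are read in
`J` and its negative ones in `I`. -/
inductive Consequence {n : ℕ} (v : Obj → D) (e : Fin n → D) (Φ : Definition L Obj n)
    (J I : RelInterp L D) : ∀ k : ℕ, L.Relations k → (Fin k → D) → Prop
  | intro (r : DefRule L Obj n) (hr : r ∈ Φ) (b : Fin r.numVars → D)
      (hb : FO.PolSat v r.body J I (Fin.append e b)) :
      Consequence v e Φ J I r.arity r.pred (fun i => Tm.val v (Fin.append e b) (r.args i))

/-- `J` agrees with `I` on the parameters of `Φ`. -/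
def Definition.SameParams {n : ℕ} (Φ : Definition L Obj n) (J I : RelInterp L D) : Prop :=
  ∀ (k : ℕ) (P : L.Relations k), (⟨k, P⟩ : PredSym L) ∉ Φ.defined → J k P = I k P

/-- `J` interprets the defined predicates of `Φ` by sets in `H`. -/
def Definition.IsPoint {n : ℕ} (Φ : Definition L Obj n) (H : ∀ k : ℕ, Set (Set (Fin k → D)))
    (J : RelInterp L D) : Prop :=
  ∀ (k : ℕ) (P : L.Relations k), (⟨k, P⟩ : PredSym L) ∈ Φ.defined → J k P ∈ H k

/-- `J` is a pre-fixpoint of `C(·, I)`. -/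
def Definition.IsPreFixed {n : ℕ} (v : Obj → D) (e : Fin n → D) (Φ : Definition L Obj n)
    (J I : RelInterp L D) : Prop :=
  ∀ (k : ℕ) (P : L.Relations k), (⟨k, P⟩ : PredSym L) ∈ Φ.defined →
    {a | Consequence v e Φ J I k P a} ⊆ J k P

/-- The structure, with the class `H`, is a Henkin model of `Φ`: its interpretation `I` of the
predicates is the least pre-fixed `H`-point of `C(·, I)`. -/
def Definition.IsHenkinModel {n : ℕ} (v : Obj → D) (H : ∀ k : ℕ, Set (Set (Fin k → D)))
    (e : Fin n → D) (Φ : Definition L Obj n) : Prop :=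
  Φ.IsPoint H (stdRel L D) ∧
  Φ.IsPreFixed v e (stdRel L D) (stdRel L D) ∧
  ∀ J : RelInterp L D, Φ.SameParams J (stdRel L D) → Φ.IsPoint H J →
    Φ.IsPreFixed v e J (stdRel L D) →
    ∀ (k : ℕ) (P : L.Relations k), (⟨k, P⟩ : PredSym L) ∈ Φ.defined → stdRel L D k P ⊆ J k P

/-- Henkin satisfaction of an FO(ID)-formula. -/
def HenkinSat (v : Obj → D) (H : ∀ k : ℕ, Set (Set (Fin k → D))) (φ : FOID L Obj 0) : Prop :=
  Fml.Sat v (fun _ e Φ => Definition.IsHenkinModel v H e Φ) φ Fin.elim0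

end Semantics

/-- The sequent `Γ ⊢ Δ` is valid under the Henkin semantics. -/
def HenkinValid {L : FirstOrder.Language.{u, u}} {Obj : Type u} (Γ Δ : Set (FOID L Obj 0)) : Prop :=
  ∀ (D : Type u) [L.Structure D] (v : Obj → D) (H : ∀ k : ℕ, Set (Set (Fin k → D))),
    IsHenkinClass L v H → (∀ φ ∈ Γ, HenkinSat v H φ) → ∃ ψ ∈ Δ, HenkinSat v H ψ

/-- Provability in the sequent calculus SC_FO(ID). -/
inductive Provable {L : FirstOrder.Language.{u, u}} {Obj : Type u} :
    Set (FOID L Obj 0) → Set (FOID L Obj 0) → Prop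
  -- structural rules
  | ax {Γ Δ} (h : (Γ ∩ Δ).Nonempty ∨ Fml.falsum ∈ Γ ∨ Fml.verum ∈ Δ) : Provable Γ Δ
  | wk {Γ Δ} (Γ₀ Δ₀ : Set (FOID L Obj 0)) (hΓ : Γ₀ ⊆ Γ) (hΔ : Δ₀ ⊆ Δ) (h : Provable Γ₀ Δ₀) :
      Provable Γ Δ
  | subst {Γ Δ} (x : Obj) (t : Tm L Obj 0) (h : Provable Γ Δ) :
      Provable (FOID.subst (single x t) '' Γ) (FOID.subst (single x t) '' Δ)
  | cut {Γ Δ} (φ : FOID L Obj 0) (h₁ : Provable Γ (insert φ Δ)) (h₂ : Provable (insert φ Γ) Δ) :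
      Provable Γ Δ
  -- logical rules
  | negL {Γ Δ} (φ : FOID L Obj 0) (h : Provable Γ (insert φ Δ)) : Provable (insert φ.neg Γ) Δ
  | negR {Γ Δ} (φ : FOID L Obj 0) (h : Provable (insert φ Γ) Δ) : Provable Γ (insert φ.neg Δ)
  | orL {Γ Δ} (φ ψ : FOID L Obj 0) (h₁ : Provable (insert φ Γ) Δ) (h₂ : Provable (insert ψ Γ) Δ) :
      Provable (insert (φ.or ψ) Γ) Δ
  | orR {Γ Δ} (φ ψ : FOID L Obj 0) (h : Provable Γ (insert φ (insert ψ Δ))) :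
      Provable Γ (insert (φ.or ψ) Δ)
  | andL {Γ Δ} (φ ψ : FOID L Obj 0) (h : Provable (insert φ (insert ψ Γ)) Δ) :
      Provable (insert (φ.and ψ) Γ) Δ
  | andR {Γ Δ} (φ ψ : FOID L Obj 0) (h₁ : Provable Γ (insert φ Δ)) (h₂ : Provable Γ (insert ψ Δ)) :
      Provable Γ (insert (φ.and ψ) Δ)
  | impL {Γ Δ} (φ ψ : FOID L Obj 0) (h₁ : Provable Γ (insert φ Δ)) (h₂ : Provable (insert ψ Γ) Δ) :
      Provable (insert (φ.imp ψ) Γ) Δ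
  | impR {Γ Δ} (φ ψ : FOID L Obj 0) (h : Provable (insert φ Γ) (insert ψ Δ)) :
      Provable Γ (insert (φ.imp ψ) Δ)
  | iffL {Γ Δ} (φ ψ : FOID L Obj 0) (h₁ : Provable Γ (insert φ (insert ψ Δ)))
      (h₂ : Provable (insert φ (insert ψ Γ)) Δ) : Provable (insert (φ.iff ψ) Γ) Δ
  | iffR {Γ Δ} (φ ψ : FOID L Obj 0) (h₁ : Provable (insert φ Γ) (insert ψ Δ))
      (h₂ : Provable (insert ψ Γ) (insert φ Δ)) : Provable Γ (insert (φ.iff ψ) Δ)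
  | allL {Γ Δ} (φ : FOID L Obj 1) (t : Tm L Obj 0)
      (h : Provable (insert (FOID.subst (plugIn fun _ => t) φ) Γ) Δ) :
      Provable (insert φ.all Γ) Δ
  | allR {Γ Δ} (φ : FOID L Obj 1) (x : Obj) (hφ : x ∉ FOID.free φ) (hΓ : x ∉ freeSet (Γ ∪ Δ))
      (h : Provable Γ (insert (FOID.subst (plugIn fun _ => objTm x) φ) Δ)) :
      Provable Γ (insert φ.all Δ)
  | exL {Γ Δ} (φ : FOID L Obj 1) (x : Obj) (hφ : x ∉ FOID.free φ) (hΓ : x ∉ freeSet (Γ ∪ Δ))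
      (h : Provable (insert (FOID.subst (plugIn fun _ => objTm x) φ) Γ) Δ) :
      Provable (insert φ.ex Γ) Δ
  | exR {Γ Δ} (φ : FOID L Obj 1) (t : Tm L Obj 0)
      (h : Provable Γ (insert (FOID.subst (plugIn fun _ => t) φ) Δ)) :
      Provable Γ (insert φ.ex Δ)
  | eqL {Γ Δ} (x y : Obj) (hxy : x ≠ y) (t s : Tm L Obj 0)
      (h : Provable (FOID.subst (double x s y t) '' Γ) (FOID.subst (double x s y t) '' Δ)) :
      Provable (insert (Fml.eq t s) (FOID.subst (double x t y s) '' Γ))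
        (FOID.subst (double x t y s) '' Δ)
  | eqR {Γ Δ} (t : Tm L Obj 0) : Provable Γ (insert (Fml.eq t t) Δ)
  -- right introduction of a defined atom, by a rule `r` of `Φ` instantiated with object symbols
  | defR {Γ Δ} (Φ : Definition L Obj 0) (r : DefRule L Obj 0) (hr : r ∈ Φ)
      (s : Fin r.numVars → Obj)
      (h : Provable (insert (Fml.ext Φ) Γ)
        (insert (FO.toFml (r.body.subst (instWith fun i => objTm (s i)))) Δ)) :
      Provable (insert (Fml.ext Φ) Γ)
        (insert (Fml.rel r.pred fun i => (r.args i).subst (instWith fun i => objTm (s i))) Δ)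
  -- left introduction of a defined atom: induction on the predicates in `S`, with hypotheses `F_Q`
  -- whose argument places are indices; `y r` names the quantified object symbols of the rule `r`
  | defL {Γ Δ} (Φ : Definition L Obj 0) (S : Set (PredSym L)) (hS : S ⊆ Φ.defined)
      {k : ℕ} (P : L.Relations k) (hP : (⟨k, P⟩ : PredSym L) ∈ S) (v : Fin k → Tm L Obj 0)
      (F : ∀ k, L.Relations k → FO L Obj k)
      (y : ∀ r : DefRule L Obj 0, Fin r.numVars → Obj)
      (hy : ∀ r ∈ Φ, Function.Injective (y r))
      (hfree : ∀ r ∈ Φ, ∀ i, y r i ∉ freeSet (Γ ∪ Δ) ∪ Definition.free Φ)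
      (hF : ∀ r ∈ Φ, ∀ i, ∀ Q ∈ S, y r i ∉ (F Q.1 Q.2).free)
      (minor : ∀ r ∈ Φ, (⟨r.arity, r.pred⟩ : PredSym L) ∈ S →
        Provable
          (insert (FO.toFml (((r.body.replace S F true)).subst (instWith fun i => objTm (y r i))))
            (insert (Fml.ext Φ) Γ))
          (insert (FO.toFml ((F r.arity r.pred).subst
            (plugIn fun j => (r.args j).subst (instWith fun i => objTm (y r i))))) Δ))
      (major : Provable
        (insert (FO.toFml ((F k P).subst (plugIn v))) (insert (Fml.ext Φ) Γ)) Δ) :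
      Provable (insert (Fml.rel P v) (insert (Fml.ext Φ) Γ)) Δ

end FOIDLogic

namespace FOIDLogic

variable {L : FirstOrder.Language.{u, u}} {Obj : Type u}

/-! ### Substitution in terms -/

/-! The argument is Henkin's, by contraposition. If the sequent is unprovable, then `Γ` together
with the negations of `Δ` is not refutable in the presence of the definitions. The definitions stay
in a fixed background `B`; only FO-formulas are ever decided. The countermodel is the term model of
a complete, witnessed extension of `Γ ∪ ¬Δ`, with the FO-definable relations as Henkin class.

Both definition rules are needed for this model to satisfy each definition (`isHenkinModel`). By
(def R), the interpretation of the defined predicates is a pre-fixpoint. For minimality, let `J` be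
a pre-fixed point made of relations of the class. Each of its relations is defined by some formula
`F_Q`, and replacing positive occurrences in rule bodies by these formulas amounts to reading them
in `J` (`holds_replace`). So pre-fixedness of `J` says that the minor premises of (def L) are true
in the model, and (def L) yields `F_P[v]` for every true atom `P(v)`, that is, inclusion in `J`. The
Henkin class is exactly what confines the competitors `J` to those that the induction rule can talk
about.

The vocabulary may be uncountable, and the object symbols outside the sequent are the only source of
fresh witnesses. The construction therefore runs in a countable fragment `K`: finitely many symbols
that cover the sequent, plus a countably infinite set `O` of object symbols. The map `collapse`
sends every formula into the fragment and commutes with instantiation, its range is countable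
(`FO.countable_range_collapse`), and every stage of the enumeration is a finite set, so a fresh
symbol of `O` always exists (`exists_decides`). Pulling the resulting theory back along `collapse`
gives a complete theory of the whole vocabulary (`henkinTheory_collapse`), from which the term model
is read off by the truth lemma `holds_elt`. -/

theorem Tm.subst_subst {n m l : ℕ} (σ : Subst L Obj n m) (τ : Subst L Obj m l) (t : Tm L Obj n) :
    (t.subst σ).subst τ = t.subst fun z => (σ z).subst τ := by
  induction t with
  | var z => rfl
  | func f ts ih => exact congrArg _ (funext ih)

theorem Tm.subst_var {n : ℕ} (t : Tm L Obj n) : t.subst FirstOrder.Language.Term.var = t := by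
  induction t with
  | var z => rfl
  | func f ts ih => exact congrArg _ (funext ih)

theorem Tm.weaken_subst {n m k : ℕ} (t : Tm L Obj n) (σ : Subst L Obj (n + k) m) :
    (Tm.weaken k t).subst σ = t.subst fun z => σ (Sum.map id (Fin.castAdd k) z) := by
  induction t with
  | var z => rfl
  | func f ts ih => exact congrArg _ (funext ih)

theorem Tm.weaken_eq_subst {n k : ℕ} (t : Tm L Obj n) :
    Tm.weaken k t = t.subst fun z => .var (Sum.map id (Fin.castAdd k) z) := by
  rw [← Tm.weaken_subst t FirstOrder.Language.Term.var, Tm.subst_var]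

theorem Tm.subst_congr {n m : ℕ} (σ τ : Subst L Obj n m) (t : Tm L Obj n)
    (hobj : ∀ x ∈ Tm.free t, σ (.inl x) = τ (.inl x)) (hidx : ∀ i, σ (.inr i) = τ (.inr i)) :
    t.subst σ = t.subst τ := by
  induction t with
  | var z =>
    rcases z with x | i
    · exact hobj x (by simp [Tm.free])
    · exact hidx i
  | func f ts ih =>
    exact congrArg (FirstOrder.Language.Term.func f) (funext fun i => ih i fun x hx => hobj x (Set.mem_iUnion.2 ⟨i, hx⟩))

theorem Tm.subst_self (σ : Subst L Obj 0 0) (hσ : ∀ x, σ (.inl x) = objTm x)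
    (t : Tm L Obj 0) : t.subst σ = t := by
  rw [Tm.subst_congr σ FirstOrder.Language.Term.var t (fun x _ => hσ x) fun i => i.elim0,
    Tm.subst_var]

theorem Tm.free_finite {n : ℕ} (t : Tm L Obj n) : (Tm.free t).Finite := by
  induction t with
  | var z => rcases z with x | i <;> simp [Tm.free]
  | func f ts ih => simpa [Tm.free] using Set.finite_iUnion ih

theorem Subst.lift_comp {n m l : ℕ} (k : ℕ) (σ : Subst L Obj n m) (τ : Subst L Obj m l) :
    (fun z => (Subst.lift k σ z).subst (Subst.lift k τ)) =
      Subst.lift k fun z => (σ z).subst τ := by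
  have key (t : Tm L Obj m) :
      (Tm.weaken k t).subst (Subst.lift k τ) = Tm.weaken k (t.subst τ) := by
    rw [Tm.weaken_subst, Tm.weaken_eq_subst, Tm.subst_subst]
    congr 1
    funext z
    rcases z with x | i
    · simp [Subst.lift, Tm.weaken_eq_subst]
    · simp [Subst.lift, Tm.weaken_eq_subst]
  funext z
  rcases z with x | i
  · exact key _
  · refine Fin.addCases (fun i => ?_) (fun j => ?_) i
    · simpa [Subst.lift] using key _
    · simp [Subst.lift]

theorem Subst.lift_var {n : ℕ} (k : ℕ) :
    Subst.lift k (FirstOrder.Language.Term.var : Subst L Obj n n) =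
      FirstOrder.Language.Term.var := by
  funext z
  rcases z with x | i
  · rfl
  · refine Fin.addCases (fun i => ?_) (fun j => ?_) i
    · simp [Subst.lift, Tm.weaken]
    · simp [Subst.lift]

theorem Subst.lift_congr {n m : ℕ} (k : ℕ) (σ τ : Subst L Obj n m)
    (hidx : ∀ i, σ (.inr i) = τ (.inr i)) (i : Fin (n + k)) :
    Subst.lift k σ (.inr i) = Subst.lift k τ (.inr i) := by
  refine Fin.addCases (fun i => ?_) (fun j => ?_) i <;> simp [Subst.lift, hidx]

/-! ### Substitution in FO-formulas -/

namespace FO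

@[simp] theorem subst_eq {n m : ℕ} (σ : Subst L Obj n m) (t s : Tm L Obj n) :
    FO.subst σ (.eq t s : FO L Obj n) = .eq (t.subst σ) (s.subst σ) := rfl
@[simp] theorem subst_rel {n m k : ℕ} (σ : Subst L Obj n m) (P : L.Relations k)
    (ts : Fin k → Tm L Obj n) :
    FO.subst σ (.rel P ts : FO L Obj n) = .rel P fun i => (ts i).subst σ := rfl
@[simp] theorem subst_neg {n m : ℕ} (σ : Subst L Obj n m) (φ : FO L Obj n) :
    FO.subst σ (.neg φ : FO L Obj n) = .neg (φ.subst σ) := rfl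
@[simp] theorem subst_and {n m : ℕ} (σ : Subst L Obj n m) (φ ψ : FO L Obj n) :
    FO.subst σ (.and φ ψ : FO L Obj n) = .and (φ.subst σ) (ψ.subst σ) := rfl
@[simp] theorem subst_or {n m : ℕ} (σ : Subst L Obj n m) (φ ψ : FO L Obj n) :
    FO.subst σ (.or φ ψ : FO L Obj n) = .or (φ.subst σ) (ψ.subst σ) := rfl
@[simp] theorem subst_imp {n m : ℕ} (σ : Subst L Obj n m) (φ ψ : FO L Obj n) :
    FO.subst σ (.imp φ ψ : FO L Obj n) = .imp (φ.subst σ) (ψ.subst σ) := rfl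
@[simp] theorem subst_iff {n m : ℕ} (σ : Subst L Obj n m) (φ ψ : FO L Obj n) :
    FO.subst σ (.iff φ ψ : FO L Obj n) = .iff (φ.subst σ) (ψ.subst σ) := rfl
@[simp] theorem subst_all {n m : ℕ} (σ : Subst L Obj n m) (φ : FO L Obj (n + 1)) :
    FO.subst σ (.all φ : FO L Obj n) = .all (φ.subst (Subst.lift 1 σ)) := rfl
@[simp] theorem subst_ex {n m : ℕ} (σ : Subst L Obj n m) (φ : FO L Obj (n + 1)) :
    FO.subst σ (.ex φ : FO L Obj n) = .ex (φ.subst (Subst.lift 1 σ)) := rfl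

theorem subst_subst {n m l : ℕ} (σ : Subst L Obj n m) (τ : Subst L Obj m l) (φ : FO L Obj n) :
    FO.subst τ (FO.subst σ φ) = FO.subst (fun z => (σ z).subst τ) φ := by
  induction φ generalizing m l with
  | ext a => exact a.elim
  | verum => rfl
  | falsum => rfl
  | eq t s => simp [Tm.subst_subst]
  | rel P ts => simp [Tm.subst_subst]
  | neg φ ih => simp [ih]
  | and φ ψ ih₁ ih₂ => simp [ih₁, ih₂]
  | or φ ψ ih₁ ih₂ => simp [ih₁, ih₂]
  | imp φ ψ ih₁ ih₂ => simp [ih₁, ih₂]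
  | iff φ ψ ih₁ ih₂ => simp [ih₁, ih₂]
  | all φ ih => simp [ih, Subst.lift_comp]
  | ex φ ih => simp [ih, Subst.lift_comp]

theorem subst_var {n : ℕ} (φ : FO L Obj n) : FO.subst FirstOrder.Language.Term.var φ = φ := by
  induction φ with
  | ext a => exact a.elim
  | verum => rfl
  | falsum => rfl
  | eq t s => simp [Tm.subst_var]
  | rel P ts => simp [Tm.subst_var]
  | neg φ ih => simp [ih]
  | and φ ψ ih₁ ih₂ => simp [ih₁, ih₂]
  | or φ ψ ih₁ ih₂ => simp [ih₁, ih₂]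
  | imp φ ψ ih₁ ih₂ => simp [ih₁, ih₂]
  | iff φ ψ ih₁ ih₂ => simp [ih₁, ih₂]
  | all φ ih => simp [ih, Subst.lift_var]
  | ex φ ih => simp [ih, Subst.lift_var]

theorem subst_congr {n m : ℕ} (σ τ : Subst L Obj n m) (φ : FO L Obj n)
    (hobj : ∀ x ∈ φ.free, σ (.inl x) = τ (.inl x)) (hidx : ∀ i, σ (.inr i) = τ (.inr i)) :
    φ.subst σ = φ.subst τ := by
  induction φ generalizing m with
  | ext a => exact a.elim
  | verum => rfl
  | falsum => rfl
  | eq t s =>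
    rw [subst_eq, subst_eq, Tm.subst_congr σ τ t (fun x hx => hobj x (Or.inl hx)) hidx,
      Tm.subst_congr σ τ s (fun x hx => hobj x (Or.inr hx)) hidx]
  | rel P ts =>
    rw [subst_rel, subst_rel]
    exact congrArg _ (funext fun i =>
      Tm.subst_congr σ τ _ (fun x hx => hobj x (Set.mem_iUnion.2 ⟨i, hx⟩)) hidx)
  | neg φ ih => rw [subst_neg, subst_neg, ih σ τ hobj hidx]
  | and φ ψ ih₁ ih₂ =>
    rw [subst_and, subst_and, ih₁ σ τ (fun x hx => hobj x (Or.inl hx)) hidx,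
      ih₂ σ τ (fun x hx => hobj x (Or.inr hx)) hidx]
  | or φ ψ ih₁ ih₂ =>
    rw [subst_or, subst_or, ih₁ σ τ (fun x hx => hobj x (Or.inl hx)) hidx,
      ih₂ σ τ (fun x hx => hobj x (Or.inr hx)) hidx]
  | imp φ ψ ih₁ ih₂ =>
    rw [subst_imp, subst_imp, ih₁ σ τ (fun x hx => hobj x (Or.inl hx)) hidx,
      ih₂ σ τ (fun x hx => hobj x (Or.inr hx)) hidx]
  | iff φ ψ ih₁ ih₂ =>
    rw [subst_iff, subst_iff, ih₁ σ τ (fun x hx => hobj x (Or.inl hx)) hidx,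
      ih₂ σ τ (fun x hx => hobj x (Or.inr hx)) hidx]
  | all φ ih =>
    rw [subst_all, subst_all, ih _ _ (fun x hx => congrArg (Tm.weaken 1) (hobj x hx))
      (Subst.lift_congr 1 σ τ hidx)]
  | ex φ ih =>
    rw [subst_ex, subst_ex, ih _ _ (fun x hx => congrArg (Tm.weaken 1) (hobj x hx))
      (Subst.lift_congr 1 σ τ hidx)]

theorem free_finite {n : ℕ} (φ : FO L Obj n) : φ.free.Finite := by
  induction φ with
  | ext a => exact a.elim
  | verum => exact Set.finite_empty
  | falsum => exact Set.finite_empty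
  | eq t s => exact (Tm.free_finite t).union (Tm.free_finite s)
  | rel P ts => exact Set.finite_iUnion fun i => Tm.free_finite _
  | neg φ ih => exact ih
  | and φ ψ ih₁ ih₂ => exact ih₁.union ih₂
  | or φ ψ ih₁ ih₂ => exact ih₁.union ih₂
  | imp φ ψ ih₁ ih₂ => exact ih₁.union ih₂
  | iff φ ψ ih₁ ih₂ => exact ih₁.union ih₂
  | all φ ih => exact ih
  | ex φ ih => exact ih

theorem subst_plugIn {n m l : ℕ} (s : Fin n → Tm L Obj m) (t : Fin m → Tm L Obj l)
    (φ : FO L Obj n) :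
    FO.subst (plugIn t) (FO.subst (plugIn s) φ) =
      FO.subst (plugIn fun i => (s i).subst (plugIn t)) φ := by
  rw [subst_subst]
  congr 1
  funext z
  rcases z with x | i <;> rfl

/-- Going under a binder and then instantiating it is one simultaneous instantiation, with the new
term in last place because the innermost binder is the last index. All quantifier cases below rest
on this. -/
theorem subst_lift_plugIn {n : ℕ} (t : Fin n → Tm L Obj 0) (s : Tm L Obj 0)
    (φ : FO L Obj (n + 1)) :
    FO.subst (plugIn fun _ => s) (FO.subst (Subst.lift 1 (plugIn t)) φ) =
      FO.subst (plugIn (Fin.snoc t s : Fin (n + 1) → Tm L Obj 0)) φ := by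
  rw [subst_subst]
  congr 1
  funext z
  rcases z with x | i
  · rfl
  · refine Fin.lastCases ?_ (fun i => ?_) i
    · have : (Fin.last n) = Fin.natAdd n (0 : Fin 1) := rfl
      simp only [Subst.lift, Sum.elim_inr, plugIn, Fin.snoc_last]
      rw [this, Fin.addCases_right]
      rfl
    · simp only [Subst.lift, Sum.elim_inr, plugIn, Fin.snoc_castSucc]
      have : i.castSucc = Fin.castAdd 1 i := rfl
      rw [this, Fin.addCases_left, Tm.weaken_subst, Tm.subst_self]
      intro x
      rfl

/-- The universal closure of a formula over its `k` innermost binders. -/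
def allN (n : ℕ) : ∀ k : ℕ, FO L Obj (n + k) → FO L Obj n
  | 0, φ => φ
  | k + 1, φ => allN n k (.all φ)

@[simp] theorem free_toFml {n : ℕ} (φ : FO L Obj n) : FOID.free φ.toFml = φ.free := by
  unfold FOID.free FO.free
  induction φ with
  | ext a => exact a.elim
  | _ => simp_all [FO.toFml, Fml.free]

@[simp] theorem toFml_subst {n m : ℕ} (σ : Subst L Obj n m) (φ : FO L Obj n) :
    FOID.subst σ φ.toFml = (φ.subst σ).toFml := by
  unfold FOID.subst FO.subst
  induction φ generalizing m with
  | ext a => exact a.elim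
  | _ => simp_all [FO.toFml, Fml.subst]

end FO

theorem instWith_eq_plugIn {n k : ℕ} (s : Fin k → Tm L Obj n) :
    instWith s = plugIn (Fin.append (fun i => .var (.inr i)) s) := rfl

/-- There are no outer indices at depth `0`, so `t` is arbitrary; this lets facts about `plugIn`
apply to rule instances. -/
theorem instWith_zero {k : ℕ} (s : Fin k → Tm L Obj 0) (t : Fin 0 → Tm L Obj 0) :
    instWith s = plugIn (Fin.append t s) := by
  rw [instWith_eq_plugIn]
  congr 2
  funext i
  exact i.elim0

theorem Definition.free_finite {n : ℕ} (Φ : Definition L Obj n) : Φ.free.Finite :=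
  Φ.finite_toSet.biUnion fun r _ =>
    (Set.finite_iUnion fun i => Tm.free_finite (r.args i)).union r.body.free_finite

/-! ### Restriction to a fragment of the vocabulary -/

/-- The symbols of a vocabulary: object, function and predicate symbols. -/
abbrev Sym (L : FirstOrder.Language.{u, u}) (Obj : Type u) : Type u :=
  Obj ⊕ (Σ k : ℕ, L.Functions k) ⊕ PredSym L

section Collapse

variable (K : Set (Sym L Obj)) (o : Obj)

open Classical in
/-- Terms with a leading symbol outside `K` are replaced by the object symbol `o`. -/
noncomputable def Tm.collapse {n : ℕ} : Tm L Obj n → Tm L Obj n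
  | .var (.inl x) => if Sum.inl x ∈ K then objTm x else objTm o
  | .var (.inr i) => .var (.inr i)
  | .func (l := l) f ts =>
      if Sum.inr (Sum.inl ⟨l, f⟩) ∈ K then .func f fun i => Tm.collapse (ts i) else objTm o

open Classical in
/-- Terms with a leading symbol outside `K` are replaced by the object symbol `o`, and atoms with
a predicate symbol outside `K` by `⊥`. -/
noncomputable def FO.collapse : ∀ {n : ℕ}, FO L Obj n → FO L Obj n
  | _, .ext a => .ext a
  | _, .verum => .verum
  | _, .falsum => .falsum
  | _, .eq t s => .eq (Tm.collapse K o t) (Tm.collapse K o s)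
  | _, .rel (k := k) P ts =>
      if Sum.inr (Sum.inr ⟨k, P⟩) ∈ K then .rel P fun i => Tm.collapse K o (ts i) else .falsum
  | _, .neg φ => .neg (collapse φ)
  | _, .and φ ψ => .and (collapse φ) (collapse ψ)
  | _, .or φ ψ => .or (collapse φ) (collapse ψ)
  | _, .imp φ ψ => .imp (collapse φ) (collapse ψ)
  | _, .iff φ ψ => .iff (collapse φ) (collapse ψ)
  | _, .all φ => .all (collapse φ)
  | _, .ex φ => .ex (collapse φ)

variable {K o}

theorem Tm.collapse_objTm {n : ℕ} {x : Obj} (hx : Sum.inl x ∈ K) :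
    Tm.collapse K o (objTm x : Tm L Obj n) = objTm x := if_pos hx

theorem Tm.collapse_weaken {n k : ℕ} (t : Tm L Obj n) :
    Tm.collapse K o (Tm.weaken k t) = Tm.weaken k (Tm.collapse K o t) := by
  induction t with
  | var z =>
    rcases z with x | i
    · simp only [Tm.weaken, FirstOrder.Language.Term.relabel, Sum.map_inl, Tm.collapse, id]
      split_ifs <;> rfl
    · rfl
  | func f ts ih =>
    simp only [Tm.weaken, FirstOrder.Language.Term.relabel, Tm.collapse] at ih ⊢
    split_ifs
    · simp [ih]
    · rfl

theorem Tm.collapse_subst {n m : ℕ} (s : Fin n → Tm L Obj m)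
    (t : Tm L Obj n) :
    Tm.collapse K o (t.subst (plugIn s)) =
      (Tm.collapse K o t).subst (plugIn fun i => Tm.collapse K o (s i)) := by
  induction t with
  | var z =>
    rcases z with x | i
    · simp only [FirstOrder.Language.Term.subst, plugIn, Sum.elim_inl, Tm.collapse]
      split_ifs <;> rfl
    · rfl
  | func f ts ih =>
    simp only [FirstOrder.Language.Term.subst, Tm.collapse, ih]
    split_ifs <;> rfl

namespace FO

theorem lift_plugIn {n m : ℕ} (s : Fin n → Tm L Obj m) :
    Subst.lift 1 (plugIn s) = plugIn (Fin.addCases (fun i => Tm.weaken 1 (s i))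
      (fun j => .var (.inr (Fin.natAdd m j)))) := rfl

/-- Only indices are instantiated, and `collapse` leaves indices alone. The induction passes binders
because the lift of a `plugIn` is again a `plugIn`, whose terms `key` computes. -/
theorem collapse_subst {n m : ℕ} (s : Fin n → Tm L Obj m) (φ : FO L Obj n) :
    collapse K o (φ.subst (plugIn s)) =
      (collapse K o φ).subst (plugIn fun i => Tm.collapse K o (s i)) := by
  have key {n m : ℕ} (s : Fin n → Tm L Obj m) : (fun i => Tm.collapse K o
      ((Fin.addCases (fun i => Tm.weaken 1 (s i)) (fun j => .var (.inr (Fin.natAdd m j))) :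
        Fin (n + 1) → Tm L Obj (m + 1)) i)) =
      Fin.addCases (fun i => Tm.weaken 1 (Tm.collapse K o (s i)))
        (fun j => .var (.inr (Fin.natAdd m j))) := by
    funext i
    refine Fin.addCases (fun i => ?_) (fun j => ?_) i
    · simp only [Fin.addCases_left, Tm.collapse_weaken]
    · simp only [Fin.addCases_right, Tm.collapse]
  induction φ generalizing m with
  | ext a => exact a.elim
  | verum => rfl
  | falsum => rfl
  | eq t s => simp [collapse, Tm.collapse_subst]
  | rel P ts =>
    simp only [collapse, subst_rel]
    split_ifs
    · simp [Tm.collapse_subst]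
    · rfl
  | neg φ ih => simp [collapse, ih]
  | and φ ψ ih₁ ih₂ => simp [collapse, ih₁, ih₂]
  | or φ ψ ih₁ ih₂ => simp [collapse, ih₁, ih₂]
  | imp φ ψ ih₁ ih₂ => simp [collapse, ih₁, ih₂]
  | iff φ ψ ih₁ ih₂ => simp [collapse, ih₁, ih₂]
  | all φ ih => simp only [collapse, subst_all, lift_plugIn, ih, key]
  | ex φ ih => simp only [collapse, subst_ex, lift_plugIn, ih, key]

theorem collapse_allN {n : ℕ} (k : ℕ) (φ : FO L Obj (n + k)) :
    collapse K o (allN n k φ) = allN n k (collapse K o φ) := by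
  induction k with
  | zero => rfl
  | succ k ih => exact ih (.all φ)

/-- The formula must already lie in the fragment: otherwise an atom to be replaced could collapse to
`⊥`, while its replacement need not. -/
theorem collapse_replace (S : Set (PredSym L))
    (F : ∀ k, L.Relations k → FO L Obj k) {n : ℕ} (b : Bool) (φ : FO L Obj n)
    (hφ : collapse K o φ = φ) :
    collapse K o (φ.replace S F b) = φ.replace S (fun k P => collapse K o (F k P)) b := by
  induction φ generalizing b with
  | ext a => exact a.elim
  | verum => rfl
  | falsum => rfl
  | eq t s => exact hφ
  | rel P ts =>
    have hts : (fun i => Tm.collapse K o (ts i)) = ts := by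
      simp only [collapse] at hφ
      split_ifs at hφ
      simpa using hφ
    simp only [replace]
    split_ifs
    · rw [collapse_subst, hts]
    · exact hφ
  | neg φ ih =>
    simp only [collapse, Fml.neg.injEq] at hφ
    simp [replace, collapse, ih _ hφ]
  | and φ ψ ih₁ ih₂ =>
    simp only [collapse, Fml.and.injEq] at hφ
    simp [replace, collapse, ih₁ _ hφ.1, ih₂ _ hφ.2]
  | or φ ψ ih₁ ih₂ =>
    simp only [collapse, Fml.or.injEq] at hφ
    simp [replace, collapse, ih₁ _ hφ.1, ih₂ _ hφ.2]
  | imp φ ψ ih₁ ih₂ =>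
    simp only [collapse, Fml.imp.injEq] at hφ
    simp [replace, collapse, ih₁ _ hφ.1, ih₂ _ hφ.2]
  | iff φ ψ ih₁ ih₂ =>
    simp only [collapse, Fml.iff.injEq] at hφ
    simp [replace, collapse, ih₁ _ hφ.1, ih₂ _ hφ.2]
  | all φ ih =>
    simp only [collapse, Fml.all.injEq] at hφ
    simp [replace, collapse, ih _ hφ]
  | ex φ ih =>
    simp only [collapse, Fml.ex.injEq] at hφ
    simp [replace, collapse, ih _ hφ]

end FO

end Collapse

/-! ### Large fragments leave an expression alone -/

open Filter

/-- A property of fragments that holds from some finite fragment on. -/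
def ForLarge (p : Set (Sym L Obj) → Prop) : Prop :=
  ∀ᶠ E : Finset (Sym L Obj) in atTop, ∀ K : Set (Sym L Obj), ↑E ⊆ K → p K

namespace ForLarge

theorem mono {p q : Set (Sym L Obj) → Prop} (hp : ForLarge p) (h : ∀ K, p K → q K) :
    ForLarge q :=
  Filter.Eventually.mono hp fun _ hE K hK => h K (hE K hK)

theorem and {p q : Set (Sym L Obj) → Prop} (hp : ForLarge p) (hq : ForLarge q) :
    ForLarge fun K => p K ∧ q K :=
  (Filter.Eventually.and hp hq).mono fun _ hE K hK => ⟨hE.1 K hK, hE.2 K hK⟩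

theorem all {ι : Type*} {s : Set ι} (hs : s.Finite) {p : ι → Set (Sym L Obj) → Prop}
    (hp : ∀ i ∈ s, ForLarge (p i)) : ForLarge fun K => ∀ i ∈ s, p i K :=
  ((Filter.eventually_all_finite hs).2 hp).mono fun _ hE K hK i hi => hE i hi K hK

theorem mem (s : Sym L Obj) : ForLarge fun K => s ∈ K := by
  classical
  exact (eventually_ge_atTop {s}).mono fun E hE K hK => hK (hE (Finset.mem_singleton_self s))

theorem collapse_tm (o : Obj) {n : ℕ} (t : Tm L Obj n) :
    ForLarge fun K => Tm.collapse K o t = t := by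
  induction t with
  | var z =>
    rcases z with x | i
    · exact (mem (.inl x)).mono fun K hK => if_pos hK
    -- Membership of `o` is a dummy condition here; the equation holds for every fragment.
    · exact (mem (.inl o)).mono fun K hK => rfl
  | func f ts ih =>
    refine ((mem (.inr (.inl ⟨_, f⟩))).and (all Set.finite_univ fun i _ => ih i)).mono ?_
    rintro K ⟨h₁, h₂⟩
    simp_all [Tm.collapse]

theorem collapse_fo (o : Obj) {n : ℕ} (φ : FO L Obj n) :
    ForLarge fun K => FO.collapse K o φ = φ := by
  induction φ with
  | ext a => exact a.elim
  | verum => exact (mem (.inl o)).mono fun K hK => rfl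
  | falsum => exact (mem (.inl o)).mono fun K hK => rfl
  | eq t s => exact ((collapse_tm o t).and (collapse_tm o s)).mono (by simp_all [FO.collapse])
  | rel P ts =>
    refine ((mem (.inr (.inr ⟨_, P⟩))).and
      (all Set.finite_univ fun i _ => collapse_tm o (ts i))).mono ?_
    rintro K ⟨h₁, h₂⟩
    simp_all [FO.collapse]
  | neg φ ih => exact ih.mono (by simp_all [FO.collapse])
  | all φ ih => exact ih.mono (by simp_all [FO.collapse])
  | ex φ ih => exact ih.mono (by simp_all [FO.collapse])
  | and φ ψ ih₁ ih₂ => exact (ih₁.and ih₂).mono (by simp_all [FO.collapse])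
  | or φ ψ ih₁ ih₂ => exact (ih₁.and ih₂).mono (by simp_all [FO.collapse])
  | imp φ ψ ih₁ ih₂ => exact (ih₁.and ih₂).mono (by simp_all [FO.collapse])
  | iff φ ψ ih₁ ih₂ => exact (ih₁.and ih₂).mono (by simp_all [FO.collapse])

end ForLarge

/-! ### A countable fragment has countably many formulas -/

section Countable

/-- Heights are handled as "from some height on", so that finitely many subexpressions are combined
by conjunction, with no maxima and no proof that the sets `below` increase. -/
theorem eventually_of_succ {p q : ℕ → Prop} (hp : ∀ᶠ h in atTop, p h)
    (h : ∀ k, p k → q (k + 1)) : ∀ᶠ h in atTop, q h := by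
  obtain ⟨N, hN⟩ := eventually_atTop.1 hp
  refine eventually_atTop.2 ⟨N + 1, fun k hk => ?_⟩
  obtain ⟨j, rfl⟩ : ∃ j, k = j + 1 := ⟨k - 1, by omega⟩
  exact h j (hN j (by omega))

variable (K : Set (Sym L Obj)) (o : Obj)

/-- The terms over `K` of height less than `h`. -/
def Tm.below (n : ℕ) : ℕ → Set (Tm L Obj n)
  | 0 => ∅
  | h + 1 => objTm '' (Sum.inl ⁻¹' K) ∪ Set.range (fun i => .var (.inr i)) ∪
      ⋃ f ∈ {f : Σ k, L.Functions k | Sum.inr (Sum.inl f) ∈ K},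
        .func f.2 '' Set.pi Set.univ fun _ => Tm.below n h

/-- The FO-formulas of height less than `h` with predicate symbols in `K` and terms in `T`. -/
def FO.below (T : ∀ n, Set (Tm L Obj n)) : ℕ → ∀ n, Set (FO L Obj n)
  | 0, _ => ∅
  | h + 1, n => {.verum, .falsum} ∪ Set.image2 .eq (T n) (T n) ∪
      (⋃ P ∈ {P : PredSym L | Sum.inr (Sum.inr P) ∈ K},
        .rel P.2 '' Set.pi Set.univ fun _ => T n) ∪
      .neg '' FO.below T h n ∪ Set.image2 .and (FO.below T h n) (FO.below T h n) ∪
      Set.image2 .or (FO.below T h n) (FO.below T h n) ∪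
      Set.image2 .imp (FO.below T h n) (FO.below T h n) ∪
      Set.image2 .iff (FO.below T h n) (FO.below T h n) ∪
      .all '' FO.below T h (n + 1) ∪ .ex '' FO.below T h (n + 1)

variable {K o}

/-- By height: each level is built from the previous one by countably many symbols of finite arity,
and every collapsed term lies in some level. -/
theorem Tm.countable_range_collapse (hK : K.Countable) (ho : Sum.inl o ∈ K) (n : ℕ) :
    (Set.range (Tm.collapse K o : Tm L Obj n → Tm L Obj n)).Countable := by
  have hbelow (h : ℕ) : (Tm.below K n h).Countable := by
    induction h with
    | zero => exact Set.countable_empty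
    | succ h ih =>
      refine (((hK.preimage Sum.inl_injective).image _).union (Set.countable_range _)).union ?_
      refine Set.Countable.biUnion
        (hK.preimage (Sum.inr_injective.comp Sum.inl_injective)) fun f _ => ?_
      exact (Set.countable_univ_pi fun _ => ih).image _
  refine (Set.countable_iUnion hbelow).mono ?_
  rintro _ ⟨t, rfl⟩
  suffices ∀ᶠ h in atTop, Tm.collapse K o t ∈ Tm.below K n h from
    Set.mem_iUnion.2 this.exists
  have hobj {x : Obj} (hx : Sum.inl x ∈ K) :
      ∀ᶠ h in atTop, (objTm x : Tm L Obj n) ∈ Tm.below K n h :=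
    eventually_of_succ (p := fun _ => True) (by simp) fun h _ => Or.inl (Or.inl ⟨x, hx, rfl⟩)
  induction t with
  | var z =>
    rcases z with x | i
    · simp only [Tm.collapse]
      split_ifs with hx
      exacts [hobj hx, hobj ho]
    · exact eventually_of_succ (p := fun _ => True) (by simp) fun h _ => Or.inl (Or.inr ⟨i, rfl⟩)
  | func f ts ih =>
    simp only [Tm.collapse]
    split_ifs with hf
    · refine eventually_of_succ (eventually_all.2 ih) fun h hts => Or.inr ?_
      exact Set.mem_biUnion (x := (⟨_, f⟩ : Σ k, L.Functions k)) hf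
        (Set.mem_image_of_mem _ fun i _ => hts i)
    · exact hobj ho

theorem FO.countable_range_collapse (hK : K.Countable) (ho : Sum.inl o ∈ K) (n : ℕ) :
    (Set.range (FO.collapse K o : FO L Obj n → FO L Obj n)).Countable := by
  let T (n : ℕ) : Set (Tm L Obj n) := Set.range (Tm.collapse K o)
  have hT (n : ℕ) : (T n).Countable := Tm.countable_range_collapse hK ho n
  have hbelow (h : ℕ) : ∀ n, (FO.below K T h n).Countable := by
    induction h with
    | zero => exact fun _ => Set.countable_empty
    | succ h ih =>
      intro n
      refine .union (.union (.union (.union (.union (.union (.union (.union (.union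
        ?_ ?_) ?_) ?_) ?_) ?_) ?_) ?_) ?_) ?_
      · exact (Set.countable_singleton _).insert _
      · exact (hT n).image2 (hT n) _
      · refine Set.Countable.biUnion
          (hK.preimage (Sum.inr_injective.comp Sum.inr_injective)) fun P _ => ?_
        exact (Set.countable_univ_pi fun _ => hT n).image _
      · exact (ih n).image _
      all_goals first
        | exact (ih n).image2 (ih n) _
        | exact (ih (n + 1)).image _
  refine (Set.countable_iUnion fun h => hbelow h n).mono ?_
  rintro _ ⟨φ, rfl⟩
  suffices ∀ᶠ h in atTop, FO.collapse K o φ ∈ FO.below K T h n from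
    Set.mem_iUnion.2 this.exists
  have triv : ∀ᶠ _h : ℕ in atTop, True := by simp
  induction φ with
  | ext a => exact a.elim
  | verum => exact eventually_of_succ triv fun h _ => by simp [FO.below, FO.collapse]
  | falsum => exact eventually_of_succ triv fun h _ => by simp [FO.below, FO.collapse]
  | eq t s => exact eventually_of_succ triv fun h _ => by simp [FO.below, FO.collapse, T]
  | rel P ts =>
    simp only [FO.collapse]
    split_ifs with hP
    · refine eventually_of_succ triv fun h _ => ?_
      simp only [FO.below, Set.mem_union]
      -- Seven kinds of formulas (negation, four binary connectives, two quantifiers) come after the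
      -- atoms in the union.
      iterate 7 left
      right
      exact Set.mem_biUnion (x := (⟨_, P⟩ : PredSym L)) hP
        (Set.mem_image_of_mem _ fun i _ => ⟨ts i, rfl⟩)
    · exact eventually_of_succ triv fun h _ => by simp [FO.below]
  | neg φ ih => exact eventually_of_succ ih fun h h₁ => by simp [FO.below, FO.collapse, h₁]
  | all φ ih => exact eventually_of_succ ih fun h h₁ => by simp [FO.below, FO.collapse, h₁]
  | ex φ ih => exact eventually_of_succ ih fun h h₁ => by simp [FO.below, FO.collapse, h₁]
  | and φ ψ ih₁ ih₂ =>
    exact eventually_of_succ (ih₁.and ih₂) fun h h₁ => by simp [FO.below, FO.collapse, h₁]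
  | or φ ψ ih₁ ih₂ =>
    exact eventually_of_succ (ih₁.and ih₂) fun h h₁ => by simp [FO.below, FO.collapse, h₁]
  | imp φ ψ ih₁ ih₂ =>
    exact eventually_of_succ (ih₁.and ih₂) fun h h₁ => by simp [FO.below, FO.collapse, h₁]
  | iff φ ψ ih₁ ih₂ =>
    exact eventually_of_succ (ih₁.and ih₂) fun h h₁ => by simp [FO.below, FO.collapse, h₁]

end Countable

/-! ### Theories refuted in the presence of definitions -/

/-- The formulas of `Γ`, together with those of `B`, are refutable in the sequent calculus. -/
def Refutes (B : Set (FOID L Obj 0)) (Γ : Set (FO L Obj 0)) : Prop :=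
  Provable (FO.toFml '' Γ ∪ B) ∅

namespace Refutes

variable {B : Set (FOID L Obj 0)} {Γ Γ' : Set (FO L Obj 0)}

theorem mono (h : Refutes B Γ) (hΓ : Γ ⊆ Γ') : Refutes B Γ' :=
  .wk _ _ (Set.union_subset_union_left _ (Set.image_mono hΓ)) le_rfl h

theorem provable_insert {φ : FO L Obj 0} (h : Refutes B (insert φ Γ)) :
    Provable (insert φ.toFml (FO.toFml '' Γ ∪ B)) ∅ := by
  simpa only [Refutes, Set.image_insert_eq, Set.insert_union] using h

theorem of_provable_insert {φ : FO L Obj 0}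
    (h : Provable (insert φ.toFml (FO.toFml '' Γ ∪ B)) ∅) : Refutes B (insert φ Γ) := by
  simpa only [Refutes, Set.image_insert_eq, Set.insert_union] using h

/-- A formula that is refuted may be concluded. -/
theorem provable_of_neg {φ : FO L Obj 0} (h : Refutes B (insert φ.neg Γ)) :
    Provable (FO.toFml '' Γ ∪ B) {φ.toFml} := by
  refine .cut (Fml.neg φ.toFml) ?_ (.wk _ _ le_rfl (Set.empty_subset _) h.provable_insert)
  exact .negR _ (.ax (.inl ⟨φ.toFml, by simp⟩))

theorem of_provable_neg {φ : FO L Obj 0} (h : Provable (FO.toFml '' Γ ∪ B) {φ.toFml}) :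
    Refutes B (insert φ.neg Γ) :=
  of_provable_insert (.negL _ (by simpa using h))

theorem cut {φ : FO L Obj 0} (h₁ : Refutes B (insert φ.neg Γ)) (h₂ : Refutes B (insert φ Γ)) :
    Refutes B Γ :=
  Provable.cut φ.toFml (by simpa using h₁.provable_of_neg) h₂.provable_insert

/-- Read contrapositively: a fresh witness for an existential formula can be added without losing
consistency. The existential formula itself is kept in the context. -/
theorem of_ex {φ : FO L Obj 1} {x : Obj} (hφ : x ∉ φ.free)
    (hΓ : x ∉ freeSet (FO.toFml '' Γ ∪ B))
    (h : Refutes B (insert (φ.subst (plugIn fun _ => objTm x)) (insert φ.ex Γ))) :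
    Refutes B (insert φ.ex Γ) := by
  have hx : x ∉ freeSet (insert (FO.toFml (.ex φ)) (FO.toFml '' Γ ∪ B)) := by
    simp only [freeSet, Set.biUnion_insert, Set.mem_union, not_or] at hΓ ⊢
    exact ⟨by rwa [FO.free_toFml], hΓ⟩
  have h' := h.provable_insert
  rw [Set.image_insert_eq, Set.insert_union] at h'
  have := Provable.exL φ.toFml x (by simpa using hφ)
    (Γ := insert (FO.toFml (.ex φ)) (FO.toFml '' Γ ∪ B)) (Δ := ∅) (by simpa using hx)
    (by simpa using h')
  exact of_provable_insert (by simpa [FO.toFml] using this)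

theorem of_neg_all {φ : FO L Obj 1} {x : Obj} (hφ : x ∉ φ.free)
    (hΓ : x ∉ freeSet (FO.toFml '' Γ ∪ B))
    (h : Refutes B (insert (φ.subst (plugIn fun _ => objTm x)).neg (insert φ.all.neg Γ))) :
    Refutes B (insert φ.all.neg Γ) := by
  have hx : x ∉ freeSet (insert (FO.toFml (.neg (.all φ))) (FO.toFml '' Γ ∪ B)) := by
    simp only [freeSet, Set.biUnion_insert, Set.mem_union, not_or] at hΓ ⊢
    exact ⟨by rwa [FO.free_toFml], hΓ⟩
  have h' := h.provable_of_neg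
  rw [Set.image_insert_eq, Set.insert_union] at h'
  have h₁ := Provable.allR φ.toFml x (by simpa using hφ)
    (Γ := insert (FO.toFml (.neg (.all φ))) (FO.toFml '' Γ ∪ B)) (Δ := ∅) (by simpa using hx)
    (by simpa using h')
  have h₂ := Provable.negL (Δ := ∅) _ h₁
  exact of_provable_insert (by simpa [FO.toFml] using h₂)

end Refutes

theorem FOID.freeSet_finite {B : Set (FOID L Obj 0)} (hB : B.Finite)
    (h : ∀ φ ∈ B, (FOID.free φ).Finite) : (freeSet B).Finite :=
  hB.biUnion h

/-! ### Extension to a complete theory with witnesses -/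

/-- Every finite part of `T` is consistent with `B`. -/
def Consistent (B : Set (FOID L Obj 0)) (T : Set (FO L Obj 0)) : Prop :=
  ∀ Γ ⊆ T, Γ.Finite → ¬ Refutes B Γ

/-- The theory `T` decides the formula `φ`, with witnesses in `O`. -/
structure Decides (O : Set Obj) (T : Set (FO L Obj 0)) (φ : FO L Obj 0) : Prop where
  decides : φ ∈ T ∨ φ.neg ∈ T
  witness_ex : ∀ ψ : FO L Obj 1, φ = .ex ψ → φ ∈ T →
    ∃ x ∈ O, ψ.subst (plugIn fun _ => objTm x) ∈ T
  witness_all : ∀ ψ : FO L Obj 1, φ = .all ψ → φ.neg ∈ T →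
    ∃ x ∈ O, (ψ.subst (plugIn fun _ => objTm x)).neg ∈ T

/-- One stage of the construction. The formula `φ` is added if that is consistent, and otherwise its
negation, which is then consistent by cut; an added `∃` or `¬∀` receives a witness. Finiteness of
`Γ` and `B` leaves a fresh symbol in the infinite set `O`. -/
theorem exists_decides_of_finite {B : Set (FOID L Obj 0)} (hB : B.Finite)
    (hBfree : ∀ φ ∈ B, (FOID.free φ).Finite) {O : Set Obj} (hO : O.Infinite)
    {Γ : Set (FO L Obj 0)} (hΓ : Γ.Finite) (hcon : ¬ Refutes B Γ) (φ : FO L Obj 0) :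
    ∃ Γ', Γ ⊆ Γ' ∧ Γ'.Finite ∧ ¬ Refutes B Γ' ∧
      (φ ∈ Γ' ∨ φ.neg ∈ Γ') ∧
      (∀ ψ : FO L Obj 1, φ = .ex ψ → φ ∈ Γ' →
        ∃ x ∈ O, ψ.subst (plugIn fun _ => objTm x) ∈ Γ') ∧
      (∀ ψ : FO L Obj 1, φ = .all ψ → φ.neg ∈ Γ' →
        ∃ x ∈ O, (ψ.subst (plugIn fun _ => objTm x)).neg ∈ Γ') := by
  have fresh (ψ : FO L Obj 1) :
      ∃ x ∈ O, x ∉ ψ.free ∧ x ∉ freeSet (FO.toFml '' Γ ∪ B) := by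
    have hfin : (ψ.free ∪ freeSet (FO.toFml '' Γ ∪ B)).Finite := by
      refine ψ.free_finite.union (FOID.freeSet_finite ((hΓ.image _).union hB) ?_)
      rintro _ (⟨χ, -, rfl⟩ | hφ)
      · simpa using χ.free_finite
      · exact hBfree _ hφ
    obtain ⟨x, hxO, hx⟩ := (hO.sdiff hfin).nonempty
    exact ⟨x, hxO, fun h => hx (.inl h), fun h => hx (.inr h)⟩
  by_cases h : Refutes B (insert φ Γ)
  · have h' : ¬ Refutes B (insert φ.neg Γ) := fun h' => hcon (h'.cut h)
    -- The clause for the other decision is vacuous, since no consistent extension of `Γ` contains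
    -- `φ`.
    have hnot : ∀ Γ', ¬ Refutes B Γ' → Γ ⊆ Γ' → φ ∉ Γ' := fun Γ' h₁ h₂ h₃ =>
      h₁ (h.mono (Set.insert_subset h₃ h₂))
    by_cases hall : ∃ ψ : FO L Obj 1, φ = .all ψ
    · obtain ⟨ψ, rfl⟩ := hall
      obtain ⟨x, hxO, hψ, hx⟩ := fresh ψ
      have hc := fun hr => h' (Refutes.of_neg_all hψ hx hr)
      have hs : Γ ⊆ insert (ψ.subst (plugIn fun _ => objTm x)).neg (insert ψ.all.neg Γ) :=
        (Set.subset_insert _ _).trans (Set.subset_insert _ _)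
      refine ⟨_, hs, (hΓ.insert _).insert _, hc, .inr (by simp), ?_, ?_⟩
      · exact fun _ _ hm => absurd hm (hnot _ hc hs)
      · rintro χ hχ -
        obtain rfl : ψ = χ := by simpa using hχ
        exact ⟨x, hxO, by simp⟩
    · refine ⟨_, Set.subset_insert _ _, hΓ.insert _, h', .inr (by simp), ?_, ?_⟩
      · exact fun _ _ hm => absurd hm (hnot _ h' (Set.subset_insert _ _))
      · exact fun ψ hψ => absurd ⟨ψ, hψ⟩ hall
  · have hnot : ∀ Γ', ¬ Refutes B Γ' → φ ∈ Γ' → φ.neg ∉ Γ' := fun Γ' h₁ h₂ h₃ => by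
      refine h₁ ((Refutes.of_provable_neg (φ := φ) (Γ := Γ') ?_).mono (Set.insert_subset h₃ le_rfl))
      exact .ax (.inl ⟨φ.toFml, .inl ⟨φ, h₂, rfl⟩, rfl⟩)
    by_cases hex : ∃ ψ : FO L Obj 1, φ = .ex ψ
    · obtain ⟨ψ, rfl⟩ := hex
      obtain ⟨x, hxO, hψ, hx⟩ := fresh ψ
      refine ⟨insert (ψ.subst (plugIn fun _ => objTm x)) (insert ψ.ex Γ),
        (Set.subset_insert _ _).trans (Set.subset_insert _ _),
        (hΓ.insert _).insert _, fun hr => h (Refutes.of_ex hψ hx hr), .inl (by simp), ?_, ?_⟩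
      · rintro χ hχ -
        obtain rfl : ψ = χ := by simpa using hχ
        exact ⟨x, hxO, by simp⟩
      · exact fun χ hχ => by simp at hχ
    · refine ⟨_, Set.subset_insert _ _, hΓ.insert _, h, .inl (by simp), ?_, ?_⟩
      · exact fun ψ hψ => absurd ⟨ψ, hψ⟩ hex
      · exact fun _ _ hm => absurd hm (hnot _ h (by simp))

/-- The stages are iterated along an enumeration of `C`. A finite part of the union lies in a single
stage, hence is consistent. -/
theorem exists_decides {B : Set (FOID L Obj 0)} (hB : B.Finite)
    (hBfree : ∀ φ ∈ B, (FOID.free φ).Finite) {O : Set Obj} (hO : O.Infinite)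
    {Γ : Set (FO L Obj 0)} (hΓ : Γ.Finite) (hcon : ¬ Refutes B Γ) {C : Set (FO L Obj 0)}
    (hC : C.Countable) :
    ∃ T, Γ ⊆ T ∧ Consistent B T ∧ ∀ φ ∈ C, Decides O T φ := by
  rcases C.eq_empty_or_nonempty with rfl | hne
  · exact ⟨Γ, le_rfl, fun Γ' h _ hr => hcon (hr.mono h), by simp⟩
  obtain ⟨f, rfl⟩ := hC.exists_eq_range hne
  let X := {Γ : Set (FO L Obj 0) // Γ.Finite ∧ ¬ Refutes B Γ}
  choose step hsub hfin hncon hdec hex hall using fun (Γ : X) (φ : FO L Obj 0) =>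
    exists_decides_of_finite hB hBfree hO Γ.2.1 Γ.2.2 φ
  let G : ℕ → X := fun k => Nat.rec ⟨Γ, hΓ, hcon⟩
    (fun k Γ => ⟨step Γ (f k), hfin Γ (f k), hncon Γ (f k)⟩) k
  have hG (k : ℕ) : (G (k + 1)).1 = step (G k) (f k) := rfl
  have hmono : Monotone fun k => (G k).1 :=
    monotone_nat_of_le_succ fun k => hsub (G k) (f k)
  have hcons : Consistent B (⋃ k, (G k).1) := by
    intro Δ hΔ hfinΔ hr
    obtain ⟨k, hk⟩ := hmono.directed_le.exists_mem_subset_of_finset_subset_biUnion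
      (s := hfinΔ.toFinset) (by simpa using hΔ)
    exact (G k).2.2 (hr.mono (by simpa using hk))
  -- Witnesses are supplied for what stage `k` decided. This excludes that the opposite formula
  -- enters the union at another stage.
  have hpair (φ : FO L Obj 0) (h₁ : φ ∈ ⋃ k, (G k).1) (h₂ : φ.neg ∈ ⋃ k, (G k).1) : False := by
    refine hcons {φ.neg, φ} (by rintro _ (rfl | rfl) <;> assumption) (by simp) ?_
    exact Refutes.of_provable_neg (.ax (.inl ⟨φ.toFml, by simp⟩))
  refine ⟨⋃ k, (G k).1, Set.subset_iUnion (fun k => (G k).1) 0, hcons, ?_⟩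
  rintro _ ⟨k, rfl⟩
  have hin {ψ : FO L Obj 0} (h : ψ ∈ step (G k) (f k)) : ψ ∈ ⋃ k, (G k).1 :=
    Set.mem_iUnion.2 ⟨k + 1, h⟩
  refine ⟨(hdec (G k) (f k)).imp hin hin, fun ψ hψ hm => ?_, fun ψ hψ hm => ?_⟩
  · rcases hdec (G k) (f k) with h | h
    · obtain ⟨x, hx, h'⟩ := hex (G k) (f k) ψ hψ h
      exact ⟨x, hx, hin h'⟩
    · exact (hpair _ hm (hin h)).elim
  · rcases hdec (G k) (f k) with h | h
    · exact (hpair _ (hin h) hm).elim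
    · obtain ⟨x, hx, h'⟩ := hall (G k) (f k) ψ hψ h
      exact ⟨x, hx, hin h'⟩

theorem FO.subst_instWith_nil (φ : FO L Obj 0) (s : Fin 0 → Tm L Obj 0) :
    FO.subst (instWith (n := 0) (k := 0) s) φ = φ := by
  conv_rhs => rw [← FO.subst_var φ]
  exact FO.subst_congr _ _ _ (fun _ _ => rfl) fun i => i.elim0

theorem FO.subst_lift_instWith {k : ℕ} (s : Fin k → Tm L Obj 0) (t : Tm L Obj 0)
    (φ : FO L Obj (0 + (k + 1))) :
    FO.subst (plugIn fun _ => t) (FO.subst (Subst.lift 1 (instWith s)) φ) =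
      φ.subst (instWith (Fin.snoc s t : Fin (k + 1) → Tm L Obj 0)) := by
  rw [instWith_zero s Fin.elim0, instWith_zero _ Fin.elim0, Fin.append_snoc]
  exact FO.subst_lift_plugIn _ _ _

/-! ### Derived rules -/

namespace Provable

variable {Γ Δ : Set (FOID L Obj 0)}

theorem of_mem {φ : FOID L Obj 0} (h₁ : φ ∈ Γ) (h₂ : φ ∈ Δ) : Provable Γ Δ :=
  .ax (.inl ⟨φ, h₁, h₂⟩)

theorem of_mem_neg {φ : FOID L Obj 0} (h₁ : φ ∈ Γ) (h₂ : Fml.neg φ ∈ Γ) : Provable Γ Δ := by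
  rw [← Set.insert_eq_of_mem h₂]
  exact .negL _ (.of_mem h₁ (Set.mem_insert _ _))

theorem allN_left {k : ℕ} (φ : FO L Obj (0 + k)) (s : Fin k → Tm L Obj 0)
    (h : Provable (insert (FO.toFml (φ.subst (instWith s))) Γ) Δ) :
    Provable (insert (FO.toFml (FO.allN 0 k φ)) Γ) Δ := by
  induction k with
  | zero => rwa [FO.subst_instWith_nil] at h
  | succ k ih =>
    refine ih (.all φ) (Fin.init s) (Provable.allL (FO.toFml _) (s (Fin.last k)) ?_)
    rw [← Fin.snoc_init_self s, ← FO.subst_lift_instWith] at h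
    rw [FO.toFml_subst]
    exact h

/-- An instance of (=L) with left side `φ[t]`, in which `x` and `y` do not occur, and right side
`φ[y]`. The premise, which sends `y` to `t`, becomes an axiom; the conclusion sends `y` to `s`. The
symbol `x` only fills the second place of the rule. -/
theorem eq_subst [Infinite Obj] (t s : Tm L Obj 0) (φ : FO L Obj 1) :
    Provable (insert (Fml.eq t s) (insert (FO.toFml (φ.subst (plugIn fun _ => t))) ∅))
      (insert (FO.toFml (φ.subst (plugIn fun _ => s))) ∅) := by
  set ψ := φ.subst (plugIn fun _ => t)
  have hfin : (φ.free ∪ ψ.free).Finite := φ.free_finite.union ψ.free_finite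
  obtain ⟨x, hx⟩ := hfin.infinite_compl.nonempty
  obtain ⟨y, hy⟩ := (hfin.insert x).infinite_compl.nonempty
  simp only [Set.mem_compl_iff, Set.mem_insert_iff, Set.mem_union, not_or] at hx hy
  have hψ (t s : Tm L Obj 0) : ψ.subst (double x t y s) = ψ := by
    conv_rhs => rw [← FO.subst_var ψ]
    refine FO.subst_congr _ _ _ (fun z hz => ?_) fun i => i.elim0
    have hzx : z ≠ x := fun h => hx.2 (h ▸ hz)
    have hzy : z ≠ y := fun h => hy.2.2 (h ▸ hz)
    simp [double, hzx, hzy]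
  have hφ (t s : Tm L Obj 0) : (φ.subst (plugIn fun _ => objTm y)).subst (double x t y s) =
      φ.subst (plugIn fun _ => s) := by
    rw [FO.subst_subst]
    refine FO.subst_congr _ _ _ (fun z hz => ?_) fun i => ?_
    · have hzx : z ≠ x := fun h => hx.1 (h ▸ hz)
      have hzy : z ≠ y := fun h => hy.2.1 (h ▸ hz)
      simp [double, hzx, hzy, plugIn]
    · simp [double, plugIn, hy.1, objTm]
  have h := Provable.eqL (Γ := insert (FO.toFml ψ) ∅)
    (Δ := insert (FO.toFml (φ.subst (plugIn fun _ => objTm y))) ∅) x y (Ne.symm hy.1) t s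
  simp only [Set.image_insert_eq, Set.image_empty, FO.toFml_subst, hψ, hφ] at h
  exact h (.of_mem (Set.mem_insert _ _) (Set.mem_insert _ _))

end Provable

/-! ### Deductive closure of a consistent theory on the formulas it decides -/

namespace Consistent

variable {B : Set (FOID L Obj 0)} {T Γ : Set (FO L Obj 0)}

theorem mem_of_provable (hT : Consistent B T) (hΓ : Γ ⊆ T) (hfin : Γ.Finite) {ψ : FO L Obj 0}
    (hψ : ψ ∈ T ∨ ψ.neg ∈ T) (h : Provable (FO.toFml '' Γ ∪ B) (insert ψ.toFml ∅)) : ψ ∈ T :=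
  hψ.resolve_right fun hn => hT _ (Set.insert_subset hn hΓ) (hfin.insert _)
    (Refutes.of_provable_neg (by simpa using h))

theorem mem_of_provable_nil (hT : Consistent B T) {ψ : FO L Obj 0}
    (hψ : ψ ∈ T ∨ ψ.neg ∈ T) (h : Provable ∅ (insert ψ.toFml ∅)) : ψ ∈ T :=
  hT.mem_of_provable (Set.empty_subset T) Set.finite_empty hψ
    (.wk _ _ (Set.empty_subset _) le_rfl h)

theorem mem_of_provable_one (hT : Consistent B T) {φ ψ : FO L Obj 0} (hφ : φ ∈ T)
    (hψ : ψ ∈ T ∨ ψ.neg ∈ T) (h : Provable (insert φ.toFml ∅) (insert ψ.toFml ∅)) : ψ ∈ T :=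
  hT.mem_of_provable (Γ := {φ}) (by simpa using hφ) (by simp) hψ
    (.wk _ _ (by simp) le_rfl h)

theorem mem_of_provable_two (hT : Consistent B T) {φ χ ψ : FO L Obj 0} (hφ : φ ∈ T) (hχ : χ ∈ T)
    (hψ : ψ ∈ T ∨ ψ.neg ∈ T)
    (h : Provable (insert φ.toFml (insert χ.toFml ∅)) (insert ψ.toFml ∅)) : ψ ∈ T :=
  hT.mem_of_provable (Γ := {φ, χ}) (Set.insert_subset hφ (by simpa using hχ)) (by simp) hψ
    (.wk _ _ (Set.insert_subset (by simp) (by simp)) le_rfl h)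

theorem not_mem_of_mem_neg (hT : Consistent B T) {φ : FO L Obj 0} (h : φ.neg ∈ T) : φ ∉ T :=
  fun h' => hT {φ.neg, φ} (by rintro _ (rfl | rfl) <;> assumption) (by simp)
    (Refutes.of_provable_neg (.of_mem (φ := φ.toFml) (by simp) (by simp)))

end Consistent

/-! ### Henkin theories -/

/-- A set of FO-formulas that behaves like the set of formulas true in a Henkin model of the
definitions in `𝒟`, every element of which is named by an object symbol. -/
structure HenkinTheory (𝒟 : Set (Definition L Obj 0)) (T : Set (FO L Obj 0)) : Prop where
  verum : .verum ∈ T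
  falsum : .falsum ∉ T
  neg (φ : FO L Obj 0) : .neg φ ∈ T ↔ φ ∉ T
  and (φ ψ : FO L Obj 0) : .and φ ψ ∈ T ↔ φ ∈ T ∧ ψ ∈ T
  or (φ ψ : FO L Obj 0) : .or φ ψ ∈ T ↔ φ ∈ T ∨ ψ ∈ T
  imp (φ ψ : FO L Obj 0) : .imp φ ψ ∈ T ↔ (φ ∈ T → ψ ∈ T)
  iff (φ ψ : FO L Obj 0) : .iff φ ψ ∈ T ↔ (φ ∈ T ↔ ψ ∈ T)
  all (φ : FO L Obj 1) : .all φ ∈ T ↔ ∀ t : Tm L Obj 0, φ.subst (plugIn fun _ => t) ∈ T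
  ex (φ : FO L Obj 1) : .ex φ ∈ T ↔ ∃ t : Tm L Obj 0, φ.subst (plugIn fun _ => t) ∈ T
  eq_refl (t : Tm L Obj 0) : .eq t t ∈ T
  eq_subst (t s : Tm L Obj 0) (φ : FO L Obj 1) :
    .eq t s ∈ T → φ.subst (plugIn fun _ => t) ∈ T → φ.subst (plugIn fun _ => s) ∈ T
  named (t : Tm L Obj 0) : ∃ x : Obj, .eq t (objTm x) ∈ T
  rule : ∀ Φ ∈ 𝒟, ∀ r ∈ Φ, ∀ s : Fin r.numVars → Obj,
    r.body.subst (instWith fun i => objTm (s i)) ∈ T →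
    .rel r.pred (fun i => (r.args i).subst (instWith fun i => objTm (s i))) ∈ T
  induction : ∀ Φ ∈ 𝒟, ∀ F : ∀ k, L.Relations k → FO L Obj k,
    (∀ r ∈ Φ, FO.allN 0 r.numVars ((r.body.replace Φ.defined F true).imp
      ((F _ r.pred).subst (plugIn r.args))) ∈ T) →
    ∀ (k : ℕ) (P : L.Relations k), (⟨k, P⟩ : PredSym L) ∈ Φ.defined → ∀ v : Fin k → Tm L Obj 0,
      .rel P v ∈ T → (F k P).subst (plugIn v) ∈ T

/-! ### From a theory of the fragment to a Henkin theory of the whole vocabulary -/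

section

variable {K : Set (Sym L Obj)} {o : Obj}

theorem FO.collapse_instWith {n k : ℕ} (s : Fin k → Tm L Obj n) (φ : FO L Obj (n + k)) :
    FO.collapse K o (φ.subst (instWith s)) =
      (FO.collapse K o φ).subst (instWith fun i => Tm.collapse K o (s i)) := by
  rw [instWith_eq_plugIn, instWith_eq_plugIn, FO.collapse_subst]
  congr 2
  funext i
  refine Fin.addCases (fun i => ?_) (fun j => ?_) i
  · simp [Tm.collapse]
  · simp

theorem Tm.collapse_instWith {n k : ℕ} (s : Fin k → Tm L Obj n) (t : Tm L Obj (n + k)) :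
    Tm.collapse K o (t.subst (instWith s)) =
      (Tm.collapse K o t).subst (instWith fun i => Tm.collapse K o (s i)) := by
  rw [instWith_eq_plugIn, instWith_eq_plugIn, Tm.collapse_subst]
  congr 2
  funext i
  refine Fin.addCases (fun i => ?_) (fun j => ?_) i
  · simp [Tm.collapse]
  · simp

variable {𝒟 : Set (Definition L Obj 0)} {T : Set (FO L Obj 0)} {O : Set Obj}

open Classical in
-- Object symbols collapse to object symbols (`s i` to itself or to `o`), and the rule lies in the
-- fragment, so the collapsed instance is again an instance that (def R) covers.
theorem collapse_rule (hT : Consistent (Fml.ext '' 𝒟) T)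
    (hdec : ∀ φ, Decides O T (FO.collapse K o φ)) {Φ : Definition L Obj 0} (hΦ : Φ ∈ 𝒟)
    {r : DefRule L Obj 0} (hr : r ∈ Φ) (hpred : Sum.inr (Sum.inr ⟨_, r.pred⟩) ∈ K)
    (hargs : ∀ i, Tm.collapse K o (r.args i) = r.args i)
    (hbody : FO.collapse K o r.body = r.body) (s : Fin r.numVars → Obj)
    (h : FO.collapse K o (r.body.subst (instWith fun i => objTm (s i))) ∈ T) :
    FO.collapse K o
      (.rel r.pred (fun i => (r.args i).subst (instWith fun i => objTm (s i)))) ∈ T := by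
  let s' : Fin r.numVars → Obj := fun i => if Sum.inl (s i) ∈ K then s i else o
  have hs' (i) : Tm.collapse K o (objTm (s i) : Tm L Obj 0) = objTm (s' i) := by
    simp only [Tm.collapse, objTm, s']
    split_ifs <;> rfl
  have hhead : FO.collapse K o
      (.rel r.pred (fun i => (r.args i).subst (instWith fun i => objTm (s i)))) =
      .rel r.pred (fun i => (r.args i).subst (instWith fun i => objTm (s' i))) := by
    simp only [FO.collapse, if_pos hpred, Tm.collapse_instWith, hargs, hs']
  have hd := (hdec (.rel r.pred
    (fun i => (r.args i).subst (instWith fun i => objTm (s i))))).decides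
  rw [hhead] at hd ⊢
  rw [FO.collapse_instWith, hbody] at h
  simp only [hs'] at h
  refine hT.mem_of_provable (Γ := {r.body.subst (instWith fun i => objTm (s' i))})
    (by simpa using h) (by simp) hd ?_
  have hmem : Fml.ext Φ ∈ FO.toFml '' {r.body.subst (instWith fun i => objTm (s' i))} ∪
      Fml.ext '' 𝒟 := .inr ⟨Φ, hΦ, rfl⟩
  rw [← Set.insert_eq_of_mem hmem]
  exact .defR Φ r hr s' (.of_mem (φ := FO.toFml (r.body.subst (instWith fun i => objTm (s' i))))
    (by simp) (by simp))

/-- If the conclusion failed, its negation and the collapsed closures of the minor premises would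
form a finite part of `T` that (def L), applied to the collapsed hypotheses `F'`, refutes. -/
theorem collapse_induction [Infinite Obj] (hT : Consistent (Fml.ext '' 𝒟) T)
    (hdec : ∀ φ, Decides O T (FO.collapse K o φ)) {Φ : Definition L Obj 0} (hΦ : Φ ∈ 𝒟)
    (hargs : ∀ r ∈ Φ, ∀ i, Tm.collapse K o (r.args i) = r.args i)
    (hbody : ∀ r ∈ Φ, FO.collapse K o r.body = r.body)
    (F : ∀ k, L.Relations k → FO L Obj k)
    (hF : ∀ r ∈ Φ, FO.collapse K o (FO.allN 0 r.numVars
      ((r.body.replace Φ.defined F true).imp ((F _ r.pred).subst (plugIn r.args)))) ∈ T)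
    (k : ℕ) (P : L.Relations k) (hP : (⟨k, P⟩ : PredSym L) ∈ Φ.defined) (v : Fin k → Tm L Obj 0)
    (h : FO.collapse K o (.rel P v) ∈ T) :
    FO.collapse K o ((F k P).subst (plugIn v)) ∈ T := by
  refine (hdec _).decides.resolve_right fun hneg => ?_
  set F' : ∀ k, L.Relations k → FO L Obj k := fun k P => FO.collapse K o (F k P)
  set v' := fun i => Tm.collapse K o (v i)
  have h' : Fml.rel P v' ∈ T := by
    simp only [FO.collapse] at h
    split_ifs at h
    · exact h
    -- An atom with a predicate symbol outside `K` collapses to `⊥`, which a consistent theory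
    -- omits.
    · refine (hT {.falsum} (by simpa using h) (by simp) (.ax (.inr (.inl ?_)))).elim
      exact .inl ⟨.falsum, rfl, rfl⟩
  rw [FO.collapse_subst] at hneg
  let χ (r : DefRule L Obj 0) : FO L Obj 0 := FO.allN 0 r.numVars
    ((r.body.replace Φ.defined F' true).imp ((F' _ r.pred).subst (plugIn r.args)))
  have hχ : ∀ r ∈ Φ, χ r ∈ T := by
    intro r hr
    have := hF r hr
    simp only [FO.collapse_allN, FO.collapse, FO.collapse_replace _ _ _ _ (hbody r hr),
      FO.collapse_subst, hargs r hr] at this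
    exact this
  let Γ : Set (FO L Obj 0) := insert (Fml.neg ((F' k P).subst (plugIn v'))) (χ '' Φ)
  have hΓ : Γ.Finite := (Φ.finite_toSet.image χ).insert _
  have hΓT : Γ ⊆ T := by
    refine Set.insert_subset hneg ?_
    rintro _ ⟨r, hr, rfl⟩
    exact hχ r hr
  -- All symbols barred by the side conditions of (def L); the `∪ ∅` matches its empty right-hand
  -- side.
  let avoid : Set Obj := (freeSet (FO.toFml '' Γ ∪ ∅) ∪ Φ.free) ∪
    ⋃ Q ∈ Φ.defined, (F' Q.1 Q.2).free
  have havoid : avoid.Finite := by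
    refine Set.Finite.union (Set.Finite.union ?_ Φ.free_finite) ?_
    · rw [Set.union_empty]
      refine FOID.freeSet_finite (hΓ.image _) ?_
      rintro _ ⟨ψ, -, rfl⟩
      simpa using ψ.free_finite
    · refine Set.Finite.biUnion ?_ fun Q _ => FO.free_finite _
      refine (Φ.finite_toSet.image fun r => (⟨r.arity, r.pred⟩ : PredSym L)).subset ?_
      rintro Q ⟨r, hr, rfl⟩
      exact ⟨r, hr, rfl⟩
  -- One enumeration of fresh symbols serves all rules: names need to be distinct only within a
  -- rule.
  let y (r : DefRule L Obj 0) (i : Fin r.numVars) : Obj :=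
    (havoid.infinite_compl.natEmbedding _ i : (avoidᶜ : Set Obj))
  have hy (r : DefRule L Obj 0) (i : Fin r.numVars) : y r i ∉ avoid :=
    (havoid.infinite_compl.natEmbedding _ i : (avoidᶜ : Set Obj)).2
  refine hT (insert (.rel P v') Γ) (Set.insert_subset h' hΓT) (hΓ.insert _) ?_
  refine .wk (insert (.rel P v') (insert (.ext Φ) (FO.toFml '' Γ))) ∅ ?_ le_rfl ?_
  · refine Set.insert_subset (.inl ⟨_, Set.mem_insert _ _, rfl⟩)
      (Set.insert_subset (.inr ⟨Φ, hΦ, rfl⟩) ?_)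
    exact Set.subset_union_of_subset_left (Set.image_mono (Set.subset_insert _ _)) _
  refine .defL Φ Φ.defined le_rfl P hP v' F' y ?_ ?_ ?_ ?_ ?_
  · intro r _ i j hij
    exact Fin.ext ((havoid.infinite_compl.natEmbedding _).injective (Subtype.ext hij))
  · exact fun r _ i hi => hy r i (.inl hi)
  · exact fun r _ i Q hQ hi => hy r i (.inr (Set.mem_biUnion hQ hi))
  · intro r hr _
    have hmem : FO.toFml (χ r) ∈
        insert (FO.toFml (((r.body.replace Φ.defined F' true)).subst
          (instWith fun i => objTm (y r i)))) (insert (Fml.ext Φ) (FO.toFml '' Γ)) :=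
      .inr (.inr ⟨_, .inr ⟨r, hr, rfl⟩, rfl⟩)
    rw [← Set.insert_eq_of_mem hmem]
    -- The minor premise is modus ponens on the closed implication, instantiated at the fresh names.
    refine .allN_left _ (fun i => objTm (y r i)) (.impL _ _ ?_ ?_)
    · exact .of_mem (Set.mem_insert _ _) (Set.mem_insert _ _)
    · refine .of_mem (Set.mem_insert _ _) (.inl ?_)
      rw [instWith_eq_plugIn]
      exact congrArg _ (FO.subst_plugIn _ _ _)
  -- The major premise closes at once, since the negated conclusion is in the context.
  · exact .of_mem_neg (Set.mem_insert _ _) (.inr (.inr ⟨_, .inl rfl, rfl⟩))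

/-- A consistent theory that decides the formulas of a fragment yields a Henkin theory. -/
theorem henkinTheory_collapse [Infinite Obj] (hO : ∀ x ∈ O, Sum.inl x ∈ K)
    (hT : Consistent (Fml.ext '' 𝒟) T) (hdec : ∀ φ, Decides O T (FO.collapse K o φ))
    (h𝒟 : ∀ Φ ∈ 𝒟, ∀ r ∈ Φ, Sum.inr (Sum.inr ⟨_, r.pred⟩) ∈ K ∧
      (∀ i, Tm.collapse K o (r.args i) = r.args i) ∧ FO.collapse K o r.body = r.body) :
    HenkinTheory 𝒟 {φ | FO.collapse K o φ ∈ T} := by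
  have hd (φ : FO L Obj 0) := (hdec φ).decides
  have hneg (φ : FO L Obj 0) : (FO.collapse K o φ).neg ∈ T ↔ FO.collapse K o φ ∉ T :=
    ⟨hT.not_mem_of_mem_neg, (hd φ).resolve_left⟩
  have hinst (φ : FO L Obj 1) (t : Tm L Obj 0) :
      FO.collapse K o (φ.subst (plugIn fun _ => t)) =
        (FO.collapse K o φ).subst (plugIn fun _ => Tm.collapse K o t) := FO.collapse_subst _ _
  constructor <;> simp only [Set.mem_ofPred_eq]
  case verum => exact hT.mem_of_provable_nil (hd .verum) (.ax (.inr (.inr (.inl rfl))))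
  case falsum =>
    exact fun h => hT {.falsum} (Set.singleton_subset_iff.2 h) (by simp)
      (.ax (.inr (.inl (.inl ⟨.falsum, rfl, rfl⟩))))
  case neg => exact hneg
  case and =>
    refine fun φ ψ => ⟨fun h => ⟨?_, ?_⟩, fun h => ?_⟩
    · exact hT.mem_of_provable_one h (hd φ)
        (.andL _ _ (.of_mem (φ := FO.toFml (FO.collapse K o φ)) (by simp) (by simp)))
    · exact hT.mem_of_provable_one h (hd ψ)
        (.andL _ _ (.of_mem (φ := FO.toFml (FO.collapse K o ψ)) (by simp) (by simp)))
    · exact hT.mem_of_provable_two h.1 h.2 (hd (.and φ ψ))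
        (.andR _ _ (.of_mem (Set.mem_insert _ _) (Set.mem_insert _ _))
          (.of_mem (.inr (Set.mem_insert _ _)) (Set.mem_insert _ _)))
  case or =>
    refine fun φ ψ => ⟨fun h => or_iff_not_imp_left.2 fun h' => ?_, fun h => ?_⟩
    · refine hT.mem_of_provable_two h ((hneg φ).2 h') (hd ψ) (.orL _ _ ?_ ?_)
      · exact .of_mem_neg (Set.mem_insert _ _) (.inr (Set.mem_insert _ _))
      · exact .of_mem (Set.mem_insert _ _) (Set.mem_insert _ _)
    · rcases h with h | h
      · exact hT.mem_of_provable_one h (hd (.or φ ψ))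
          (.orR _ _ (.of_mem (Set.mem_insert _ _) (Set.mem_insert _ _)))
      · exact hT.mem_of_provable_one h (hd (.or φ ψ))
          (.orR _ _ (.of_mem (Set.mem_insert _ _) (.inr (Set.mem_insert _ _))))
  case imp =>
    refine fun φ ψ => ⟨fun h h' => ?_, fun h => ?_⟩
    · exact hT.mem_of_provable_two h h' (hd ψ)
        (.impL _ _ (.of_mem (Set.mem_insert _ _) (Set.mem_insert _ _))
          (.of_mem (Set.mem_insert _ _) (Set.mem_insert _ _)))
    · by_cases h' : FO.collapse K o φ ∈ T
      · exact hT.mem_of_provable_one (h h') (hd (.imp φ ψ))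
          (.impR _ _ (.of_mem (.inr (Set.mem_insert _ _)) (Set.mem_insert _ _)))
      · exact hT.mem_of_provable_one ((hneg φ).2 h') (hd (.imp φ ψ))
          (.impR _ _ (.of_mem_neg (Set.mem_insert _ _) (.inr (Set.mem_insert _ _))))
  case iff =>
    refine fun φ ψ => ⟨fun h => ⟨fun h' => ?_, fun h' => ?_⟩, fun h => ?_⟩
    · exact hT.mem_of_provable_two h h' (hd ψ)
        (.iffL _ _ (.of_mem (Set.mem_insert _ _) (Set.mem_insert _ _))
          (.of_mem (.inr (Set.mem_insert _ _)) (Set.mem_insert _ _)))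
    · exact hT.mem_of_provable_two h h' (hd φ)
        (.iffL _ _ (.of_mem (Set.mem_insert _ _) (.inr (Set.mem_insert _ _)))
          (.of_mem (Set.mem_insert _ _) (Set.mem_insert _ _)))
    · by_cases h' : FO.collapse K o φ ∈ T
      · exact hT.mem_of_provable_two h' (h.1 h') (hd (.iff φ ψ))
          (.iffR _ _ (.of_mem (.inr (.inr (Set.mem_insert _ _))) (Set.mem_insert _ _))
            (.of_mem (.inr (Set.mem_insert _ _)) (Set.mem_insert _ _)))
      · exact hT.mem_of_provable_two ((hneg φ).2 h') ((hneg ψ).2 fun hψ => h' (h.2 hψ))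
          (hd (.iff φ ψ))
          (.iffR _ _ (.of_mem_neg (Set.mem_insert _ _) (.inr (Set.mem_insert _ _)))
            (.of_mem_neg (Set.mem_insert _ _) (.inr (.inr (Set.mem_insert _ _)))))
  case all =>
    refine fun φ => ⟨fun h t => ?_, fun h => (hd (.all φ)).resolve_right fun hn => ?_⟩
    · refine hT.mem_of_provable_one h (hd _) (.allL _ (Tm.collapse K o t) ?_)
      rw [FO.toFml_subst, hinst]
      exact .of_mem (Set.mem_insert _ _) (Set.mem_insert _ _)
    · obtain ⟨x, hx, hm⟩ := (hdec (.all φ)).witness_all _ rfl hn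
      refine hT.not_mem_of_mem_neg hm ?_
      have := h (objTm x)
      rwa [hinst, Tm.collapse_objTm (hO x hx)] at this
  case ex =>
    refine fun φ => ⟨fun h => ?_, fun ⟨t, h⟩ => ?_⟩
    · obtain ⟨x, hx, hm⟩ := (hdec (.ex φ)).witness_ex _ rfl h
      exact ⟨objTm x, by rwa [hinst, Tm.collapse_objTm (hO x hx)]⟩
    · refine hT.mem_of_provable_one h (hd (.ex φ)) (.exR _ (Tm.collapse K o t) ?_)
      rw [FO.toFml_subst, hinst]
      exact .of_mem (Set.mem_insert _ _) (Set.mem_insert _ _)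
  case eq_refl => exact fun t => hT.mem_of_provable_nil (hd (.eq t t)) (.eqR _)
  case eq_subst =>
    intro t s φ h₁ h₂
    have h₃ := hd (φ.subst (plugIn fun _ => s))
    rw [hinst] at h₂ h₃ ⊢
    exact hT.mem_of_provable_two h₁ h₂ h₃ (.eq_subst _ _ _)
  case named =>
    intro t
    -- The formula `∃ x : t = x` is provable by (=R), and its witness in `T` is an object symbol.
    let φ : FO L Obj 1 := .eq (Tm.weaken 1 t) (.var (.inr 0))
    have hφ (s : Tm L Obj 0) : (FO.collapse K o φ).subst (plugIn fun _ => s) =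
        .eq (Tm.collapse K o t) s := by
      simp only [φ, FO.collapse, FO.subst_eq, Tm.collapse_weaken]
      exact congrArg₂ Fml.eq
        ((Tm.weaken_subst _ _).trans (Tm.subst_self (fun z => plugIn (fun _ => s) (Sum.map id (Fin.castAdd 1) z))
            (fun _ => rfl) _)) rfl
    have hex : FO.collapse K o (.ex φ) ∈ T := by
      refine hT.mem_of_provable_nil (hd (.ex φ)) (.exR _ (Tm.collapse K o t) ?_)
      rw [FO.toFml_subst, hφ]
      exact .eqR _
    obtain ⟨x, hx, hm⟩ := (hdec (.ex φ)).witness_ex _ rfl hex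
    rw [hφ] at hm
    refine ⟨x, ?_⟩
    rw [← Tm.collapse_objTm (o := o) (hO x hx)] at hm
    exact hm
  case rule =>
    intro Φ hΦ r hr s h
    obtain ⟨h₁, h₂, h₃⟩ := h𝒟 Φ hΦ r hr
    exact collapse_rule hT hdec hΦ hr h₁ h₂ h₃ s h
  case induction =>
    intro Φ hΦ F hF k P hP v h
    exact collapse_induction hT hdec hΦ (fun r hr => (h𝒟 Φ hΦ r hr).2.1)
      (fun r hr => (h𝒟 Φ hΦ r hr).2.2) F hF k P hP v h

end

/-! ### The term model of a Henkin theory -/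

/-- A closed term, seen below `n` binders. -/
def Tm.up {n : ℕ} (t : Tm L Obj 0) : Tm L Obj n := t.subst (plugIn Fin.elim0)

theorem Tm.up_subst {n : ℕ} (s : Fin n → Tm L Obj 0) (t : Tm L Obj 0) :
    (Tm.up t : Tm L Obj n).subst (plugIn s) = t := by
  rw [Tm.up, Tm.subst_subst]
  exact Tm.subst_self (fun z => (plugIn Fin.elim0 z).subst (plugIn s)) (fun _ => rfl) t

theorem FO.subst_nil (φ : FO L Obj 0) (s : Fin 0 → Tm L Obj 0) : φ.subst (plugIn s) = φ := by
  conv_rhs => rw [← FO.subst_var φ]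
  exact FO.subst_congr _ _ _ (fun _ _ => rfl) fun i => i.elim0

section Holds

variable {D : Type u} [L.Structure D]

/-- Satisfaction of an FO-formula. -/
def FO.Holds (v : Obj → D) {n : ℕ} (φ : FO L Obj n) (e : Fin n → D) : Prop :=
  FO.PolSat v φ (stdRel L D) (stdRel L D) e

theorem FO.sat_toFml {A : ℕ → Type u} (v : Obj → D) (satA : ∀ n, (Fin n → D) → A n → Prop)
    {n : ℕ} (φ : FO L Obj n) (e : Fin n → D) :
    Fml.Sat v satA (FO.toFml φ) e ↔ φ.Holds v e := by
  unfold FO.Holds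
  induction φ with
  | ext a => exact a.elim
  | verum => exact Iff.rfl
  | falsum => exact Iff.rfl
  | eq t s => exact Iff.rfl
  | rel P ts => exact Iff.rfl
  | neg φ ih => exact not_congr (ih e)
  | and φ ψ ih₁ ih₂ => exact and_congr (ih₁ e) (ih₂ e)
  | or φ ψ ih₁ ih₂ => exact or_congr (ih₁ e) (ih₂ e)
  | imp φ ψ ih₁ ih₂ => exact imp_congr (ih₁ e) (ih₂ e)
  | iff φ ψ ih₁ ih₂ => exact (iff_congr (ih₁ e) (ih₂ e)).trans iff_iff_implies_and_implies
  | all φ ih => exact forall_congr' fun d => ih _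
  | ex φ ih => exact exists_congr fun d => ih _

end Holds

namespace HenkinTheory

variable {𝒟 : Set (Definition L Obj 0)} {T : Set (FO L Obj 0)}

theorem eq_symm (h : HenkinTheory 𝒟 T) {t s : Tm L Obj 0} (hts : .eq t s ∈ T) :
    .eq s t ∈ T := by
  have := h.eq_subst t s (.eq (.var (.inr 0)) (Tm.up t)) hts
  simp only [FO.subst_eq, Tm.up_subst] at this
  exact this (h.eq_refl t)

theorem eq_trans (h : HenkinTheory 𝒟 T) {t s r : Tm L Obj 0} (hts : .eq t s ∈ T)
    (hsr : .eq s r ∈ T) : .eq t r ∈ T := by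
  have := h.eq_subst s r (.eq (Tm.up t) (.var (.inr 0))) hsr
  simp only [FO.subst_eq, Tm.up_subst] at this
  exact this hts

/-- One argument at a time, the last one first; `ψ` is `φ` with the last place already filled, so
that the induction hypothesis treats the others. -/
theorem eq_substs (h : HenkinTheory 𝒟 T) {k : ℕ} (φ : FO L Obj k) (ts ss : Fin k → Tm L Obj 0)
    (hts : ∀ i, .eq (ts i) (ss i) ∈ T) (hφ : φ.subst (plugIn ts) ∈ T) :
    φ.subst (plugIn ss) ∈ T := by
  induction k with
  | zero => rwa [Subsingleton.elim ss ts]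
  | succ k ih =>
    have hφ' : φ.subst (plugIn (Fin.snoc (Fin.init ts) (ss (Fin.last k)) :
        Fin (k + 1) → Tm L Obj 0)) ∈ T := by
      rw [← FO.subst_lift_plugIn]
      refine h.eq_subst _ _ _ (hts (Fin.last k)) ?_
      rwa [FO.subst_lift_plugIn, Fin.snoc_init_self]
    let ψ : FO L Obj k := φ.subst (plugIn (Fin.snoc (fun i => .var (.inr i))
      (Tm.up (ss (Fin.last k))) : Fin (k + 1) → Tm L Obj k))
    have hψ (rs : Fin k → Tm L Obj 0) : ψ.subst (plugIn rs) =
        φ.subst (plugIn (Fin.snoc rs (ss (Fin.last k)) : Fin (k + 1) → Tm L Obj 0)) := by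
      rw [FO.subst_plugIn]
      congr 2
      funext i
      refine Fin.lastCases ?_ (fun i => ?_) i
      · simp [Tm.up_subst]
      · simp [plugIn]
    rw [← hψ] at hφ'
    have := ih ψ (Fin.init ts) (Fin.init ss) (fun i => hts i.castSucc) hφ'
    rwa [hψ, Fin.snoc_init_self] at this

theorem allN_mem (h : HenkinTheory 𝒟 T) {k : ℕ} (φ : FO L Obj (0 + k))
    (hφ : ∀ s : Fin k → Tm L Obj 0, φ.subst (instWith s) ∈ T) : FO.allN 0 k φ ∈ T := by
  induction k with
  | zero => exact FO.subst_instWith_nil φ Fin.elim0 ▸ hφ Fin.elim0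
  | succ k ih =>
    refine ih (.all φ) fun s => (h.all _).2 fun t => ?_
    have := hφ (Fin.snoc s t)
    rw [← FO.subst_lift_instWith] at this
    exact this

/-- Closed terms, up to provable equality. -/
def setoid (h : HenkinTheory 𝒟 T) : Setoid (Tm L Obj 0) where
  r t s := .eq t s ∈ T
  iseqv := ⟨h.eq_refl, h.eq_symm, h.eq_trans⟩

/-- The domain of the term model. -/
def Model (h : HenkinTheory 𝒟 T) : Type u := Quotient h.setoid

/-- The element of the term model named by a term. -/
def elt (h : HenkinTheory 𝒟 T) (t : Tm L Obj 0) : h.Model := Quotient.mk h.setoid t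

/-- A term that names an element of the term model. -/
noncomputable def name (h : HenkinTheory 𝒟 T) (d : h.Model) : Tm L Obj 0 := Quotient.out d

variable (h : HenkinTheory 𝒟 T)

@[simp] theorem elt_name (d : h.Model) : h.elt (h.name d) = d := Quotient.out_eq d

theorem elt_eq_elt {t s : Tm L Obj 0} : h.elt t = h.elt s ↔ .eq t s ∈ T :=
  Quotient.eq (r := h.setoid)

theorem name_elt (t : Tm L Obj 0) : .eq (h.name (h.elt t)) t ∈ T := h.elt_eq_elt.1 (h.elt_name _)

noncomputable instance : L.Structure h.Model where
  funMap f a := h.elt (.func f fun i => h.name (a i))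
  RelMap P a := .rel P (fun i => h.name (a i)) ∈ T

/-- Every object symbol names itself in the term model. -/
def assign (x : Obj) : h.Model := h.elt (objTm x)

/-- Equality is a congruence, so the representatives chosen in the structure do not matter. -/
theorem funMap_elt {k : ℕ} (f : L.Functions k) (ts : Fin k → Tm L Obj 0) :
    FirstOrder.Language.Structure.funMap f (fun i => h.elt (ts i)) = h.elt (.func f ts) := by
  refine h.elt_eq_elt.2 (h.eq_symm ?_)
  have := h.eq_substs (.eq (Tm.up (.func f ts)) (.func f fun i => .var (.inr i))) ts
    (fun i => h.name (h.elt (ts i))) (fun i => h.eq_symm (h.name_elt _))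
  simp only [FO.subst_eq, Tm.up_subst] at this
  exact this (h.eq_refl _)

theorem mem_stdRel {k : ℕ} (P : L.Relations k) (ts : Fin k → Tm L Obj 0) :
    (fun i => h.elt (ts i)) ∈ stdRel L h.Model k P ↔ .rel P ts ∈ T :=
  ⟨h.eq_substs (.rel P fun i => .var (.inr i)) _ ts fun _ => h.name_elt _,
    h.eq_substs (.rel P fun i => .var (.inr i)) ts _ fun _ => h.eq_symm (h.name_elt _)⟩

theorem val_elt {n : ℕ} (ts : Fin n → Tm L Obj 0) (t : Tm L Obj n) :
    Tm.val h.assign (fun i => h.elt (ts i)) t = h.elt (t.subst (plugIn ts)) := by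
  induction t with
  | var z => rcases z with x | i <;> rfl
  | func f ss ih =>
    simp only [Tm.val, FirstOrder.Language.Term.realize] at ih ⊢
    simp only [ih]
    exact h.funMap_elt f _

theorem snoc_elt {n : ℕ} (ts : Fin n → Tm L Obj 0) (t : Tm L Obj 0) :
    (Fin.snoc (fun i => h.elt (ts i)) (h.elt t) : Fin (n + 1) → h.Model) =
      fun i => h.elt ((Fin.snoc ts t : Fin (n + 1) → Tm L Obj 0) i) := by
  funext i
  refine Fin.lastCases ?_ (fun i => ?_) i <;> simp

theorem append_elt {k : ℕ} (ts : Fin k → Tm L Obj 0) :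
    Fin.append Fin.elim0 (fun i => h.elt (ts i)) =
      fun i => h.elt (Fin.append Fin.elim0 ts i) := by
  funext i
  refine Fin.addCases (fun i => i.elim0) (fun i => ?_) i
  simp

/-- The truth lemma. The clauses of `HenkinTheory` match Tarski's; for quantifiers, every element of
the model is the value of a closed term. -/
theorem holds_elt {n : ℕ} (φ : FO L Obj n) (ts : Fin n → Tm L Obj 0) :
    φ.Holds h.assign (fun i => h.elt (ts i)) ↔ φ.subst (plugIn ts) ∈ T := by
  unfold FO.Holds
  induction φ with
  | ext a => exact a.elim
  | verum => exact iff_of_true trivial h.verum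
  | falsum => exact iff_of_false id h.falsum
  | eq t s =>
    simp only [FO.PolSat, val_elt]
    exact h.elt_eq_elt
  | rel P ss =>
    simp only [FO.PolSat, val_elt]
    exact h.mem_stdRel P _
  | neg φ ih => exact (not_congr (ih ts)).trans (h.neg _).symm
  | and φ ψ ih₁ ih₂ => exact (and_congr (ih₁ ts) (ih₂ ts)).trans (h.and _ _).symm
  | or φ ψ ih₁ ih₂ => exact (or_congr (ih₁ ts) (ih₂ ts)).trans (h.or _ _).symm
  | imp φ ψ ih₁ ih₂ => exact (imp_congr (ih₁ ts) (ih₂ ts)).trans (h.imp _ _).symm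
  | iff φ ψ ih₁ ih₂ =>
    exact (iff_iff_implies_and_implies.symm.trans (iff_congr (ih₁ ts) (ih₂ ts))).trans
      (h.iff _ _).symm
  | all φ ih =>
    refine Iff.trans ?_ (h.all (FO.subst (Subst.lift 1 (plugIn ts)) φ)).symm
    simp only [FO.subst_lift_plugIn, ← ih, ← snoc_elt]
    exact ⟨fun H t => H _, fun H d => h.elt_name d ▸ H (h.name d)⟩
  | ex φ ih =>
    refine Iff.trans ?_ (h.ex (FO.subst (Subst.lift 1 (plugIn ts)) φ)).symm
    simp only [FO.subst_lift_plugIn, ← ih, ← snoc_elt]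
    exact ⟨fun ⟨d, H⟩ => ⟨h.name d, (h.elt_name d).symm ▸ H⟩, fun ⟨t, H⟩ => ⟨_, H⟩⟩

theorem exists_names {n : ℕ} (e : Fin n → h.Model) :
    ∃ ts : Fin n → Tm L Obj 0, e = fun i => h.elt (ts i) :=
  ⟨fun i => h.name (e i), by simp⟩

/-- Names by object symbols, not just by terms, are required because (def R) instantiates rules with
object symbols only. -/
theorem exists_objects {n : ℕ} (e : Fin n → h.Model) :
    ∃ s : Fin n → Obj, e = fun i => h.elt (objTm (s i)) := by
  choose s hs using fun i => h.named (h.name (e i))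
  exact ⟨s, funext fun i => (h.elt_name _).symm.trans (h.elt_eq_elt.2 (hs i))⟩

theorem val_up {n : ℕ} (e : Fin n → h.Model) (t : Tm L Obj 0) :
    Tm.val h.assign e (Tm.up t) = h.elt t := by
  obtain ⟨ts, rfl⟩ := h.exists_names e
  rw [val_elt, Tm.up_subst]

/-- No induction on `φ`: the truth lemma turns both sides into membership in `T`, where the two
instantiations compose. -/
theorem holds_subst {n k : ℕ} (φ : FO L Obj k) (s : Fin k → Tm L Obj n) (e : Fin n → h.Model) :
    (φ.subst (plugIn s)).Holds h.assign e ↔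
      φ.Holds h.assign fun i => Tm.val h.assign e (s i) := by
  obtain ⟨ts, rfl⟩ := h.exists_names e
  simp only [val_elt, holds_elt, FO.subst_plugIn]

/-! ### The Henkin class of definable relations, and the definitions in the term model -/

/-- The relations on the term model that are defined by FO-formulas. -/
def definable (k : ℕ) : Set (Set (Fin k → h.Model)) :=
  Set.range fun φ : FO L Obj k => {a | φ.Holds h.assign a}

/-- Each closure condition is an operation on defining formulas. Parameters are harmless, since
closed terms name all elements. -/
theorem isHenkinClass_definable : IsHenkinClass L h.assign h.definable where
  equality := ⟨.eq (.var (.inr 0)) (.var (.inr 1)), rfl⟩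
  predicate Q := ⟨.rel Q fun i => .var (.inr i), rfl⟩
  projection := by
    rintro k _ d ⟨φ, rfl⟩
    refine ⟨φ.subst (plugIn (Fin.snoc (fun i => .var (.inr i)) (Tm.up (h.name d)))), ?_⟩
    ext a
    refine (h.holds_subst _ _ _).trans (iff_of_eq (congrArg _ (funext fun i => ?_)))
    refine Fin.lastCases ?_ (fun i => ?_) i
    · simp [val_up]
    · simp [Tm.val]
  terms := by
    rintro k n m _ t x y b ⟨φ, rfl⟩ - - -
    -- The syntactic counterpart of the nested reassignment: `x` becomes the indices, `y` the names
    -- of the parameters `b`, and other symbols stay.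
    let ρ : Subst L Obj 0 n := Sum.elim (Function.extend x (fun j => .var (.inr j))
      (Function.extend y (fun j => Tm.up (h.name (b j))) objTm)) Fin.elim0
    refine ⟨φ.subst (plugIn fun i => (t i).subst ρ), ?_⟩
    ext a
    refine (h.holds_subst _ _ _).trans (iff_of_eq (congrArg _ (funext fun i => ?_)))
    simp only [Tm.val, FirstOrder.Language.Term.realize_subst]
    congr 1
    funext z
    rcases z with z | i
    · simp only [ρ, Sum.elim_inl]
      rw [Function.apply_extend (FirstOrder.Language.Term.realize (Sum.elim h.assign a))]
      congr 1
      funext z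
      simp only [Function.comp_apply]
      rw [Function.apply_extend (FirstOrder.Language.Term.realize (Sum.elim h.assign a))]
      congr 1
      funext j
      exact (h.val_up a _).trans (h.elt_name _)
    · exact i.elim0
  complement := by
    rintro k _ ⟨φ, rfl⟩
    exact ⟨.neg φ, rfl⟩
  intersection := by
    rintro k _ _ ⟨φ, rfl⟩ ⟨ψ, rfl⟩
    exact ⟨.and φ ψ, rfl⟩
  universal := by
    rintro k _ ⟨φ, rfl⟩
    exact ⟨.all φ, rfl⟩

/-- The Boolean tracks the sign: `J` occupies the place of the occurrences being replaced, the
structure the other. The clause for `⇔` fits because `replace` and `PolSat` unwind it alike. -/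
theorem holds_replace (S : Set (PredSym L)) (F : ∀ k, L.Relations k → FO L Obj k)
    (J : RelInterp L h.Model)
    (hF : ∀ k (P : L.Relations k), (⟨k, P⟩ : PredSym L) ∈ S →
      J k P = {a | (F k P).Holds h.assign a})
    (hJ : ∀ k (P : L.Relations k), (⟨k, P⟩ : PredSym L) ∉ S → J k P = stdRel L h.Model k P)
    {n : ℕ} (φ : FO L Obj n) (b : Bool) (e : Fin n → h.Model) :
    (φ.replace S F b).Holds h.assign e ↔
      FO.PolSat h.assign φ (cond b J (stdRel L h.Model)) (cond (!b) J (stdRel L h.Model)) e := by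
  induction φ generalizing b with
  | ext a => exact a.elim
  | verum => exact Iff.rfl
  | falsum => exact Iff.rfl
  | eq t s => exact Iff.rfl
  | rel P ts =>
    simp only [FO.replace, FO.PolSat]
    split_ifs with hb
    · rw [holds_subst, hb.1, cond_true, hF _ P hb.2]
      rfl
    · cases b
      · exact Iff.rfl
      · rw [cond_true, hJ _ P fun hP => hb ⟨rfl, hP⟩]
        exact Iff.rfl
  | neg φ ih =>
    have h₁ := ih (!b) e
    rw [Bool.not_not] at h₁
    exact not_congr h₁
  | and φ ψ ih₁ ih₂ => exact and_congr (ih₁ b e) (ih₂ b e)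
  | or φ ψ ih₁ ih₂ => exact or_congr (ih₁ b e) (ih₂ b e)
  | imp φ ψ ih₁ ih₂ =>
    have h₁ := ih₁ (!b) e
    rw [Bool.not_not] at h₁
    exact imp_congr h₁ (ih₂ b e)
  | iff φ ψ ih₁ ih₂ =>
    have h₁ := ih₁ (!b) e
    have h₂ := ih₂ (!b) e
    rw [Bool.not_not] at h₁ h₂
    exact and_congr (imp_congr h₁ (ih₂ b e)) (imp_congr h₂ (ih₁ b e))
  | all φ ih => exact forall_congr' fun d => ih b _
  | ex φ ih => exact exists_congr fun d => ih b _

theorem isHenkinModel {Φ : Definition L Obj 0} (hΦ : Φ ∈ 𝒟) :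
    Φ.IsHenkinModel h.assign h.definable Fin.elim0 := by
  refine ⟨fun k P _ => h.isHenkinClass_definable.predicate P, ?_, ?_⟩
  · rintro k P - _ ⟨r, hr, b, hb⟩
    -- Pre-fixpoint: the values of the rule's variables are named by object symbols, so closure
    -- under (def R) applies.
    obtain ⟨s, rfl⟩ := h.exists_objects b
    rw [append_elt] at hb ⊢
    simp only [val_elt]
    rw [mem_stdRel, ← instWith_zero]
    refine h.rule Φ hΦ r hr s ?_
    rw [instWith_zero _ Fin.elim0]
    exact (h.holds_elt _ _).1 hb
  · intro J hJ hpoint hpre k P hP a ha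
    -- The induction hypotheses `F` are formulas defining the competitor `J`; on undefined
    -- predicates the choice `⊥` is a mere default.
    have : ∀ k (P : L.Relations k), ∃ φ : FO L Obj k, (⟨k, P⟩ : PredSym L) ∈ Φ.defined →
        J k P = {a | φ.Holds h.assign a} := by
      intro k P
      by_cases hP : (⟨k, P⟩ : PredSym L) ∈ Φ.defined
      · obtain ⟨φ, hφ⟩ := hpoint k P hP
        exact ⟨φ, fun _ => hφ.symm⟩
      · exact ⟨.falsum, fun h => absurd h hP⟩
    choose F hF using this
    obtain ⟨v, rfl⟩ := h.exists_names a
    rw [hF k P hP]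
    refine (h.holds_elt _ _).2 (h.induction Φ hΦ F (fun r hr => ?_) k P hP v
      ((h.mem_stdRel P v).1 ha))
    refine h.allN_mem _ fun s => ?_
    rw [instWith_zero _ Fin.elim0, ← holds_elt]
    intro hbody
    have hr' : (⟨r.arity, r.pred⟩ : PredSym L) ∈ Φ.defined := ⟨r, hr, rfl⟩
    refine (h.holds_subst _ _ _).2 ?_
    have hcons := (h.holds_replace Φ.defined F J hF hJ r.body true _).1 hbody
    rw [← append_elt] at hcons ⊢
    -- Pre-fixedness of `J` is precisely the truth of the minor premise for the rule `r`.
    have := hpre _ _ hr' (Consequence.intro r hr _ hcons)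
    rwa [hF _ _ hr'] at this

end HenkinTheory

/-! ### Completeness -/

/-- Each formula changes sides by a cut on its negation, since `φ, ¬φ` is provable on the right. -/
theorem Provable.of_neg_left {Γ Δ Δ' : Set (FOID L Obj 0)} (hΔ : Δ.Finite)
    (h : Provable (Fml.neg '' Δ ∪ Γ) Δ') : Provable Γ (Δ ∪ Δ') := by
  induction Δ, hΔ using Set.Finite.induction_on generalizing Δ' with
  | empty => simpa using h
  | @insert φ Δ _ _ ih =>
    rw [Set.insert_union, ← Set.union_insert]
    refine ih (.cut φ.neg (.negR _ (.of_mem (Set.mem_insert _ _) (Set.mem_insert _ _))) ?_)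
    rw [Set.image_insert_eq, Set.insert_union] at h
    exact .wk _ _ le_rfl (Set.subset_insert _ _) h

end FOIDLogic

open FOIDLogic in
theorem mainTheorem4 {L : FirstOrder.Language.{u, u}} {Obj : Type u} [Infinite Obj]
    (Γ Δ : Set (FOIDLogic.FO L Obj 0)) (hΓ : Γ.Finite) (hΔ : Δ.Finite)
    (m : ℕ) (Φ : Fin m → FOIDLogic.Definition L Obj 0)
    (hvalid : FOIDLogic.HenkinValid
      (FOIDLogic.FO.toFml '' Γ ∪ Set.range fun i => FOIDLogic.Fml.ext (Φ i))
      (FOIDLogic.FO.toFml '' Δ)) :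
    FOIDLogic.Provable
      (FOIDLogic.FO.toFml '' Γ ∪ Set.range fun i => FOIDLogic.Fml.ext (Φ i))
      (FOIDLogic.FO.toFml '' Δ) := by
  have hrange : (Set.range fun i => Fml.ext (Φ i) : Set (FOID L Obj 0)) =
      Fml.ext '' Set.range Φ := Set.range_comp Fml.ext Φ
  rw [hrange] at hvalid ⊢
  by_contra hprov
  have hcon : ¬ Refutes (Fml.ext '' Set.range Φ) (Γ ∪ Fml.neg '' Δ) := by
    intro hr
    refine hprov ?_
    rw [← Set.union_empty (FO.toFml '' Δ)]
    refine .of_neg_left (hΔ.image _) (.wk _ _ ?_ le_rfl hr)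
    rw [Set.image_union, Set.image_image, Set.image_image, Set.union_comm (FO.toFml '' Γ),
      Set.union_assoc]
    exact le_rfl
  let o : Obj := Infinite.natEmbedding Obj 0
  let O : Set Obj := Set.range (Infinite.natEmbedding Obj)
  have hO : O.Infinite := Set.infinite_range_of_injective (Infinite.natEmbedding Obj).injective
  have hlarge := (ForLarge.all (hΓ.union hΔ) fun φ _ => ForLarge.collapse_fo o φ).and
    (ForLarge.all (Set.finite_range Φ) fun Ψ _ => ForLarge.all Ψ.finite_toSet fun r _ =>
      (ForLarge.mem (.inr (.inr ⟨_, r.pred⟩))).and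
        ((ForLarge.all Set.finite_univ fun i _ => ForLarge.collapse_tm o (r.args i)).and
          (ForLarge.collapse_fo o r.body)))
  obtain ⟨E, hE⟩ := hlarge.exists
  -- The finite part `E` makes `collapse` fix every formula and rule of the sequent; `O` supplies
  -- the witnesses and contains the default `o`.
  let K : Set (Sym L Obj) := ↑E ∪ Sum.inl '' O
  have hK : K.Countable := E.countable_toSet.union ((Set.countable_range _).image _)
  have hOK : ∀ x ∈ O, Sum.inl x ∈ K := fun x hx => .inr ⟨x, hx, rfl⟩
  obtain ⟨hfml, hdef⟩ := hE K Set.subset_union_left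
  obtain ⟨T, hsub, hT, hdec⟩ := exists_decides ((Set.finite_range Φ).image _)
    (by rintro _ ⟨Ψ, -, rfl⟩; exact Ψ.free_finite) hO (hΓ.union (hΔ.image _)) hcon
    (FO.countable_range_collapse hK (hOK o ⟨0, rfl⟩) 0)
  have h := henkinTheory_collapse hOK hT (fun φ => hdec _ ⟨φ, rfl⟩) fun Ψ hΨ r hr =>
    ⟨(hdef Ψ hΨ r hr).1, fun i => (hdef Ψ hΨ r hr).2.1 i trivial, (hdef Ψ hΨ r hr).2.2⟩
  -- Formulas of the sequent are fixed by `collapse`, so membership in the pulled-back theory is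
  -- membership in `T`.
  have htruth : ∀ φ ∈ Γ ∪ Δ, HenkinSat h.assign h.definable φ.toFml ↔ φ ∈ T := by
    intro φ hφ
    refine (FO.sat_toFml _ _ _ _).trans ?_
    rw [Subsingleton.elim Fin.elim0 fun i => h.elt (Fin.elim0 i), h.holds_elt, FO.subst_nil,
      Set.mem_ofPred_eq, hfml φ hφ]
  obtain ⟨_, ⟨φ, hφ, rfl⟩, hsat⟩ := hvalid h.Model h.assign h.definable
    h.isHenkinClass_definable (by
      rintro _ (⟨φ, hφ, rfl⟩ | ⟨Ψ, hΨ, rfl⟩)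
      · exact (htruth φ (.inl hφ)).2 (hsub (.inl hφ))
      · exact h.isHenkinModel hΨ)
  exact hT.not_mem_of_mem_neg (hsub (.inr ⟨φ, hφ, rfl⟩)) ((htruth φ (.inr hφ)).1 hsat)
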